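/- **Theorem 3.10.** Let $\mathbb T=\{z\in\mathbb C:|z|=1\}$, let $\mathbb D$ be the open unit disk, and let $\mu$ be a finite positive Borel measure with $\operatorname{supp}\mu=\mathbb T$. Let $\langle p,q\rangle=\int p\,\overline q\,d\mu$, and let $\rho_k$ be the monic orthogonal polynomial of degree $k$ for $\mu$. For a polynomial $P$ regarded as having degree $\le m$, write $P^*(z)=z^m\,\overline{P(1/\overline z)}$. For $k\ge1$ put $F_k(z)=z\rho_{k-1}(z)/\rho_{k-1}^*(z)$, where $m=k-1$. A polynomial $Q$ of degree exactly $n$ is called $\tau$-invariant, with $\tau\in\mathbb T$, if $Q=\tau Q^*$ (with $m=n$); it is invariant if it is $\tau$-invariant for some $\tau\in\mathbb T$. An $(n,2\ell+1)$-QPOPUC (quasi-paraorthogonal polynomial) is an invariant polynomial of degree $n$ that is orthogonal to $\operatorname{span}\{z^k:\ell+1\le k\le n-\ell-1\}$ (the zero space if $n=2\ell+1$). Let $\ell\ge0$ and $n\ge 2\ell+1$ be integers, let $\alpha_1,\dots,\alpha_{2\ell+1}\in\mathbb T$ be distinct, and assume that the numbers $f_i=\overline{F_{n-\ell}(\alpha_i)}$,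 $i=1,\dots,2\ell+1$, are distinct as well. Put $$\mathcal V_1=[\alpha_i^j]_{i=1,\dots,\ell}^{j=0,\dots,\ell-1},\quad \mathcal V_1'=[\alpha_i^j]_{i=1,\dots,\ell}^{j=0,\dots,\ell},\quad \mathcal V_2=[\alpha_i^j]_{i=\ell+1,\dots,2\ell+1}^{j=0,\dots,\ell},\quad \mathcal V_2'=[\alpha_i^j]_{i=\ell+1,\dots,2\ell+1}^{j=0,\dots,\ell-1},$$ $\mathcal F_1=\operatorname{diag}(f_1,\dots,f_\ell)$, $\mathcal F_2=\operatorname{diag}(f_{\ell+1},\dots,f_{2\ell+1})$, $\mathbf d_1=[\alpha_1^\ell,\dots,\alpha_\ell^\ell]^T$, $\mathbf d_2=[\alpha_{\ell+1}^\ell,\dots,\alpha_{2\ell+1}^\ell]^T$, and assume $$\Delta=\det\begin{bmatrix}\mathcal V_1&\mathcal F_1\mathcal V_1'\\ \mathcal V_2'&\mathcal F_2\mathcal V_2\end{bmatrix}\neq0 .$$ Let $P_\ell(z)=p_0+p_1z+\dots+p_{\ell-1}z^{\ell-1}+z^\ell$, where $$[p_0,\dots,p_{\ell-1}]^T=-\left[\mathcal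 V_1-\mathcal F_1\mathcal V_1'\mathcal V_2^{-1}\overline{\mathcal F_2}\,\mathcal V_2'\right]^{-1}\left[\mathbf d_1-\mathcal F_1\mathcal V_1'\mathcal V_2^{-1}\overline{\mathcal F_2}\,\mathbf d_2\right].$$ Define rational functions by $$s_\ell=\frac{P_\ell}{P_\ell^*}\ \ (m=\ell),\qquad s_{k-1}(z)=\frac1z\,\frac{s_k(z)-s_k(0)}{1-\overline{s_k(0)}\,s_k(z)},\quad k=\ell,\ell-1,\dots,2,$$ and assume that $s_k(0)\in\mathbb D$ for $k=1,\dots,\ell$. Then there exists a unique monic $(n,2\ell+1)$-QPOPUC $Q$ that has all its zeros simple and on $\mathbb T$ and has $\alpha_1,\dots,\alpha_{2\ell+1}$ among its zeros. It is given by $$Q(z)=zP_\ell(z)\rho_{n-\ell-1}(z)+\tau P_\ell^*(z)\rho_{n-\ell-1}^*(z),\qquad \tau=(-1)^{\ell+1}\,\frac{\overline\Delta}{\Delta}\prod_{j=1}^{2\ell+1}f_j\alpha_j^\ell ,$$ where $P_\ell^*$ is taken with $m=\ell$ and $\rho_{n-\ell-1}^*$ with $m=n-\ell-1$. Moreover $\tau\in\mathbb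 T$, and $Q$ is $\tau$-invariant. -/

import Mathlib

open Polynomial

namespace QPOPUC

noncomputable section

open scoped ComplexConjugate

/-- The reciprocal polynomial `P^*(z) = z^n * conj (P (1 / conj z))` of a polynomial `P` of degree at
most `n`: it has the coefficients `conj p_n, …, conj p_0`. -/
def recip (n : ℕ) (P : ℂ[X]) : ℂ[X] := (P.map (starRingEnd ℂ)).reflect n

/-- The inner product `⟨P, Q⟩ = ∫ P(z) conj (Q(z)) dμ(z)`. -/
def ip (μ : MeasureTheory.Measure ℂ) (P Q : ℂ[X]) : ℂ :=
  ∫ z, P.eval z * conj (Q.eval z) ∂μ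

/-- The monic orthogonal (Szegő) polynomials `ρ_n`: orthogonalization of `1, z, z^2, …`. -/
def opuc (μ : MeasureTheory.Measure ℂ) (n : ℕ) : ℂ[X] :=
  X ^ n - ∑ k : Fin n, C (ip μ (X ^ n) (opuc μ k) / ip μ (opuc μ k) (opuc μ k)) * opuc μ k
termination_by n
decreasing_by exact k.2

/-- `F_k(z) = z * ρ_{k-1}(z) / ρ_{k-1}^*(z)`, for `k ≥ 1`. -/
def blaschkeF (μ : MeasureTheory.Measure ℂ) (k : ℕ) (z : ℂ) : ℂ :=
  z * (opuc μ (k - 1)).eval z / (recip (k - 1) (opuc μ (k - 1))).eval z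

/-- `Q` has degree `n` and is `τ`-invariant: `Q = τ Q^*`, where `|τ| = 1`. -/
def IsInvariantWith (n : ℕ) (τ : ℂ) (Q : ℂ[X]) : Prop :=
  ‖τ‖ = 1 ∧ Q.degree = n ∧ Q = C τ * recip n Q

/-- The span of `z^k` for `k = ℓ+1, …, n-ℓ-1` (the zero space if `n = 2ℓ+1`). -/
def testSpace (n ℓ : ℕ) : Submodule ℂ ℂ[X] :=
  Submodule.span ℂ ((fun k : ℕ => (X : ℂ[X]) ^ k) '' Set.Icc (ℓ + 1) (n - ℓ - 1))

/-- `Q` is an `(n, 2ℓ+1)`-quasi-paraorthogonal polynomial: an invariant polynomial of degree `n`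
that is orthogonal to `span {z^k : k = ℓ+1, …, n-ℓ-1}`. -/
def IsQPOPUC (μ : MeasureTheory.Measure ℂ) (n ℓ : ℕ) (Q : ℂ[X]) : Prop :=
  (∃ τ : ℂ, IsInvariantWith n τ Q) ∧ ∀ R ∈ testSpace n ℓ, ip μ Q R = 0

/-- All zeros of `Q` are simple and lie on the unit circle. -/
def AllZerosSimpleOnCircle (Q : ℂ[X]) : Prop :=
  ∀ z : ℂ, Q.IsRoot z → ‖z‖ = 1 ∧ Q.rootMultiplicity z = 1

section Matrices

variable {ℓ : ℕ}

/-- The first `ℓ` of the `2ℓ+1` entries of a vector. -/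
def fstPart (v : Fin (2 * ℓ + 1) → ℂ) (i : Fin ℓ) : ℂ := v ⟨i, by omega⟩

/-- The last `ℓ+1` of the `2ℓ+1` entries of a vector. -/
def sndPart (v : Fin (2 * ℓ + 1) → ℂ) (i : Fin (ℓ + 1)) : ℂ := v ⟨ℓ + i, by omega⟩

/-- `V_1`, of size `ℓ × ℓ`. -/
def V₁ (α : Fin (2 * ℓ + 1) → ℂ) : Matrix (Fin ℓ) (Fin ℓ) ℂ :=
  Matrix.of fun i j => fstPart α i ^ (j : ℕ)

/-- `V_1'`, of size `ℓ × (ℓ+1)`. -/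
def V₁' (α : Fin (2 * ℓ + 1) → ℂ) : Matrix (Fin ℓ) (Fin (ℓ + 1)) ℂ :=
  Matrix.of fun i j => fstPart α i ^ (j : ℕ)

/-- `V_2`, of size `(ℓ+1) × (ℓ+1)`. -/
def V₂ (α : Fin (2 * ℓ + 1) → ℂ) : Matrix (Fin (ℓ + 1)) (Fin (ℓ + 1)) ℂ :=
  Matrix.of fun i j => sndPart α i ^ (j : ℕ)

/-- `V_2'`, of size `(ℓ+1) × ℓ`. -/
def V₂' (α : Fin (2 * ℓ + 1) → ℂ) : Matrix (Fin (ℓ + 1)) (Fin ℓ) ℂ :=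
  Matrix.of fun i j => sndPart α i ^ (j : ℕ)

/-- `F_1 = diag (f_1, …, f_ℓ)`. -/
def F₁ (f : Fin (2 * ℓ + 1) → ℂ) : Matrix (Fin ℓ) (Fin ℓ) ℂ :=
  Matrix.diagonal (fstPart f)

/-- `F_2 = diag (f_{ℓ+1}, …, f_{2ℓ+1})`. -/
def F₂ (f : Fin (2 * ℓ + 1) → ℂ) : Matrix (Fin (ℓ + 1)) (Fin (ℓ + 1)) ℂ :=
  Matrix.diagonal (sndPart f)

/-- The entrywise conjugate of `F_2`. -/
def conjF₂ (f : Fin (2 * ℓ + 1) → ℂ) : Matrix (Fin (ℓ + 1)) (Fin (ℓ + 1)) ℂ :=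
  (F₂ f).map conj

/-- `d_1 = (α_1^ℓ, …, α_ℓ^ℓ)`. -/
def d₁ (α : Fin (2 * ℓ + 1) → ℂ) (i : Fin ℓ) : ℂ := fstPart α i ^ ℓ

/-- `d_2 = (α_{ℓ+1}^ℓ, …, α_{2ℓ+1}^ℓ)`. -/
def d₂ (α : Fin (2 * ℓ + 1) → ℂ) (i : Fin (ℓ + 1)) : ℂ := sndPart α i ^ ℓ

/-- The determinant `Δ` of the block matrix `[V_1, F_1 V_1'; V_2', F_2 V_2]`. -/
def Delta (α f : Fin (2 * ℓ + 1) → ℂ) : ℂ :=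
  (Matrix.fromBlocks (V₁ α) (F₁ f * V₁' α) (V₂' α) (F₂ f * V₂ α)).det

open Matrix in
/-- The vector `(p_0, …, p_{ℓ-1})`, equal to
`-[V_1 - F_1 V_1' V_2⁻¹ conj(F_2) V_2']⁻¹ [d_1 - F_1 V_1' V_2⁻¹ conj(F_2) d_2]`. -/
def pVec (α f : Fin (2 * ℓ + 1) → ℂ) : Fin ℓ → ℂ :=
  -((V₁ α - F₁ f * V₁' α * (V₂ α)⁻¹ * conjF₂ f * V₂' α)⁻¹ *ᵥ
      (d₁ α - (F₁ f * V₁' α * (V₂ α)⁻¹ * conjF₂ f) *ᵥ d₂ α))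

/-- `P_ℓ(z) = p_0 + p_1 z + ⋯ + p_{ℓ-1} z^{ℓ-1} + z^ℓ`. -/
def polyP (α f : Fin (2 * ℓ + 1) → ℂ) : ℂ[X] :=
  X ^ ℓ + ∑ j : Fin ℓ, C (pVec α f j) * X ^ (j : ℕ)

end Matrices

/-- The value of a rational function at `0`. -/
def valZero (s : RatFunc ℂ) : ℂ := s.eval (RingHom.id ℂ) 0

/-- The Schur step `s ↦ z⁻¹ (s(z) - s(0)) / (1 - conj(s(0)) s(z))`. -/
def schurStep (s : RatFunc ℂ) : RatFunc ℂ :=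
  (RatFunc.X)⁻¹ *
    ((s - RatFunc.C (valZero s)) / (1 - RatFunc.C (conj (valZero s)) * s))

/-- The functions `s_k`, `k = ℓ, ℓ-1, …`, of a polynomial `P` of degree `ℓ`:
`s_ℓ = P / P^*`, and `s_{k-1}` is obtained from `s_k` by a Schur step. -/
def schurFun (ℓ : ℕ) (P : ℂ[X]) (k : ℕ) : RatFunc ℂ :=
  schurStep^[ℓ - k] (algebraMap ℂ[X] (RatFunc ℂ) P / algebraMap ℂ[X] (RatFunc ℂ) (recip ℓ P))

/-- The Schur–Cohn condition: `s_k(0)` lies in the open unit disk for `k = 1, …, ℓ`. -/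
def SchurCohn (ℓ : ℕ) (P : ℂ[X]) : Prop :=
  ∀ k : ℕ, 1 ≤ k → k ≤ ℓ → ‖valZero (schurFun ℓ P k)‖ < 1

/-- The number `(-1)^{ℓ+1} (conj Δ / Δ) ∏_j f_j α_j^ℓ`. -/
def tauParam {ℓ : ℕ} (α f : Fin (2 * ℓ + 1) → ℂ) : ℂ :=
  (-1) ^ (ℓ + 1) * (conj (Delta α f) / Delta α f) * ∏ j, f j * α j ^ ℓ

end

end QPOPUC

/-! Put m = n-ℓ-1. On the circle, multiplication by z is unitary and ρ_m^* = z^m conj ρ_m, so zAρ_m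
+ Bρ_m^* with deg A, deg B ≤ ℓ is orthogonal to the test space. A dimension count shows that every
admissible Q has this form (`exists_eq_X_mul_mul_opuc_add`). At a point α_i the factor zρ_m can be
divided out, and Q(α_i) = 0 becomes A(α_i) + f_i B(α_i) = 0. For monic Q the leading coefficient of
A is 1, which leaves 2ℓ+1 unknowns in 2ℓ+1 linear equations with determinant Δ. This gives
uniqueness.

Block elimination identifies A with P_ℓ. Conjugating the equations shows that the pair (B^*, A^*)
satisfies them too; comparing the two pairs forces B = cA^* with |c| = 1 and c = B(0)
(`polyP_interpolation`). Cramer's rule, with a symmetry of the block matrix under conjugation, gives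
c = τ (`det_updateCol_blockMatrix`, `eq_tauParam_of_mulVec`).

Hence Q = zH + τH^* with H = P_ℓ ρ_m. The zeros of H lie in the open disk: those of P_ℓ by the Schur
recursion (`norm_lt_one_of_schurCohn`), those of ρ_m by orthogonality
(`norm_lt_one_of_isRoot_opuc`). Any such zH + τH^* has only simple zeros, all on the circle
(`allZerosSimpleOnCircle_X_mul_add`). -/

namespace QPOPUC

open scoped ComplexConjugate

/-! ### Algebra of the reciprocal polynomial -/

section Recip

theorem coeff_recip {n k : ℕ} (hk : k ≤ n) (P : ℂ[X]) :
    (recip n P).coeff k = conj (P.coeff (n - k)) := by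
  simp [recip, coeff_reflect, revAt_le hk]

/-- `reflect` leaves indices above n in place, which is why `recip_recip` needs no degree bound. -/
theorem coeff_recip_of_lt {n k : ℕ} (hk : n < k) (P : ℂ[X]) :
    (recip n P).coeff k = conj (P.coeff k) := by
  simp [recip, coeff_reflect, revAt_eq_self_of_lt hk]

theorem natDegree_recip_le {n : ℕ} {P : ℂ[X]} (hP : P.natDegree ≤ n) :
    (recip n P).natDegree ≤ n := by
  rw [natDegree_le_iff_coeff_eq_zero] at hP ⊢
  intro k hk
  rw [coeff_recip_of_lt hk, hP k hk, map_zero]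

theorem recip_recip (n : ℕ) (P : ℂ[X]) : recip n (recip n P) = P := by
  ext k
  rcases le_or_gt k n with hk | hk
  · rw [coeff_recip hk, coeff_recip (Nat.sub_le n k), Nat.sub_sub_self hk, Complex.conj_conj]
  · rw [coeff_recip_of_lt hk, coeff_recip_of_lt hk, Complex.conj_conj]

theorem recip_add (n : ℕ) (P Q : ℂ[X]) : recip n (P + Q) = recip n P + recip n Q := by
  simp [recip, reflect_add]

theorem recip_sub (n : ℕ) (P Q : ℂ[X]) : recip n (P - Q) = recip n P - recip n Q := by
  simp [recip, reflect_sub]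

theorem recip_C_mul (n : ℕ) (c : ℂ) (P : ℂ[X]) :
    recip n (C c * P) = C (conj c) * recip n P := by
  simp [recip, reflect_C_mul]

theorem recip_mul {a b : ℕ} {P Q : ℂ[X]} (hP : P.natDegree ≤ a) (hQ : Q.natDegree ≤ b) :
    recip (a + b) (P * Q) = recip a P * recip b Q := by
  simp only [recip, Polynomial.map_mul]
  exact reflect_mul _ _ (natDegree_map_le.trans hP) (natDegree_map_le.trans hQ)

theorem recip_one_X : recip 1 X = 1 := by
  simp [recip]

theorem recip_X_mul {a : ℕ} {P : ℂ[X]} (hP : P.natDegree ≤ a) :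
    recip (a + 1) (X * P) = recip a P := by
  rw [add_comm, recip_mul (by simp) hP, recip_one_X, one_mul]

theorem recip_zero_one : recip 0 1 = 1 := by
  simp [recip]

theorem eval_recip {n : ℕ} {P : ℂ[X]} (hP : P.natDegree ≤ n) {z : ℂ} (hz : z ≠ 0) :
    (recip n P).eval z = z ^ n * conj (P.eval (conj z)⁻¹) := by
  have hz' : z⁻¹ ≠ 0 := inv_ne_zero hz
  let _ : Invertible z⁻¹ := invertibleOfNonzero hz'
  have h := eval₂_reflect_mul_pow (RingHom.id ℂ) z⁻¹ n (P.map (starRingEnd ℂ))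
    (natDegree_map_le.trans hP)
  rw [invOf_eq_inv, inv_inv, eval₂_id, eval₂_id] at h
  have h2 : (P.map (starRingEnd ℂ)).eval z⁻¹ = conj (P.eval (conj z)⁻¹) := by
    have := eval_map_apply (starRingEnd ℂ) (p := P) (conj z)⁻¹
    simpa using this
  rw [← h2, ← h, recip, inv_pow]
  field_simp

theorem inv_conj_of_norm_one {z : ℂ} (hz : ‖z‖ = 1) : (conj z)⁻¹ = z := by
  rw [← Complex.inv_eq_conj hz, inv_inv]

theorem eval_recip_of_norm_one {n : ℕ} {P : ℂ[X]} (hP : P.natDegree ≤ n) {z : ℂ}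
    (hz : ‖z‖ = 1) : (recip n P).eval z = z ^ n * conj (P.eval z) := by
  rw [eval_recip hP (by rintro rfl; simp at hz), inv_conj_of_norm_one hz]

theorem coeff_zero_recip {n : ℕ} {P : ℂ[X]} (hP : P.Monic) (hn : P.natDegree = n) :
    (recip n P).coeff 0 = 1 := by
  rw [coeff_recip (Nat.zero_le n), Nat.sub_zero, ← hn, hP.coeff_natDegree, map_one]

theorem recip_ne_zero {n : ℕ} {P : ℂ[X]} (hP : P ≠ 0) : recip n P ≠ 0 := by
  intro h
  apply hP
  rw [← recip_recip n P, h]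
  simp [recip]

/-- The operator z d/dz scales the coefficient of z^k by k, and reversal turns k into n-k. -/
theorem X_mul_derivative_recip {n : ℕ} {P : ℂ[X]} (hP : P.natDegree ≤ n) :
    X * derivative (recip n P) = recip n (C (n : ℂ) * P - X * derivative P) := by
  have hcoeff : ∀ (R : ℂ[X]) (k : ℕ), (X * derivative R).coeff k = k * R.coeff k := by
    intro R k
    cases k with
    | zero => simp
    | succ k => rw [coeff_X_mul, coeff_derivative]; push_cast; ring
  ext k
  rw [hcoeff]
  rcases le_or_gt k n with hk | hk
  · rw [coeff_recip hk, coeff_recip hk, coeff_sub, coeff_C_mul, hcoeff, Nat.cast_sub hk]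
    simp only [map_sub, map_mul, map_natCast]
    ring
  · have h0 := natDegree_le_iff_coeff_eq_zero.1 hP k hk
    rw [coeff_recip_of_lt hk, coeff_recip_of_lt hk, coeff_sub, coeff_C_mul, hcoeff, h0]
    simp

end Recip

/-! ### Zeros of zH + τH^* when H has its zeros in the open disk -/

section Zeros

theorem norm_add_conj_mul_le {a A B : ℂ} (ha : ‖a‖ ≤ 1) (hAB : ‖B‖ ≤ ‖A‖) :
    ‖B + conj a * A‖ ≤ ‖A + a * B‖ := by
  have h1 : ‖A + a * B‖ ^ 2 - ‖B + conj a * A‖ ^ 2 = (1 - ‖a‖ ^ 2) * (‖A‖ ^ 2 - ‖B‖ ^ 2) := by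
    simp only [← Complex.normSq_eq_norm_sq, Complex.normSq_apply, Complex.add_re, Complex.add_im,
      Complex.mul_re, Complex.mul_im, Complex.conj_re, Complex.conj_im]
    ring
  have h2 : 0 ≤ (1 - ‖a‖ ^ 2) * (‖A‖ ^ 2 - ‖B‖ ^ 2) := by
    apply mul_nonneg
    · nlinarith [norm_nonneg a]
    · nlinarith [norm_nonneg A, norm_nonneg B]
  exact (sq_le_sq₀ (norm_nonneg _) (norm_nonneg _)).1 (by linarith)

/-- The bound holds factor by factor: |1 - conj ζ z| ≤ |z - ζ| when |ζ| < 1 ≤ |z|. -/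
theorem norm_eval_recip_prod_le (s : Multiset ℂ) (hs : ∀ ζ ∈ s, ‖ζ‖ < 1) {z : ℂ}
    (hz : 1 ≤ ‖z‖) :
    ‖(recip (Multiset.card s) (s.map fun ζ => X - C ζ).prod).eval z‖ ≤
      ‖((s.map fun ζ => X - C ζ).prod).eval z‖ := by
  induction s using Multiset.induction_on with
  | empty => simp [recip_zero_one]
  | cons ζ s ih =>
    have hd : (s.map fun ζ => X - C ζ).prod.natDegree ≤ Multiset.card s :=
      (natDegree_multiset_prod_X_sub_C_eq_card s).le
    have h1 : recip 1 (X - C ζ) = 1 - C (conj ζ) * X := by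
      rw [recip_sub, recip_one_X, recip, map_C, reflect_C, pow_one]
    rw [Multiset.map_cons, Multiset.prod_cons, Multiset.card_cons, add_comm,
      recip_mul (natDegree_X_sub_C_le ζ) hd, h1, eval_mul, eval_mul, norm_mul, norm_mul]
    refine mul_le_mul ?_ (ih fun w hw => hs w (Multiset.mem_cons_of_mem hw)) (norm_nonneg _)
      (norm_nonneg _)
    have := norm_add_conj_mul_le (a := -ζ) (A := z) (B := 1)
      (by simpa using (hs ζ (Multiset.mem_cons_self ζ s)).le) (by simpa using hz)
    simpa [sub_eq_add_neg] using this

variable {H : ℂ[X]} {m : ℕ}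

theorem norm_eval_recip_le (hH : H.Monic) (hm : H.natDegree = m)
    (hroots : ∀ z, H.IsRoot z → ‖z‖ < 1) {z : ℂ} (hz : 1 ≤ ‖z‖) :
    ‖(recip m H).eval z‖ ≤ ‖H.eval z‖ := by
  have hs := IsAlgClosed.splits H
  have hprod := hs.eq_prod_roots_of_monic hH
  have h := norm_eval_recip_prod_le H.roots (fun ζ hζ => hroots ζ (isRoot_of_mem_roots hζ)) hz
  rwa [← hprod, ← hs.natDegree_eq_card_roots, hm] at h

/-- The map w ↦ 1/(1-w), here at w = ζ/z, sends the disk into the half-plane Re > 1/2. -/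
theorem half_le_re_div_sub {z ζ : ℂ} (hz : ‖z‖ = 1) (hζ : ‖ζ‖ < 1) :
    1 / 2 ≤ (z / (z - ζ)).re := by
  have hne : z - ζ ≠ 0 := by
    intro h
    rw [sub_eq_zero.1 h] at hz
    linarith
  have hpos : 0 < Complex.normSq (z - ζ) := Complex.normSq_pos.2 hne
  have h1 : Complex.normSq z = 1 := by rw [Complex.normSq_eq_norm_sq, hz, one_pow]
  have h2 : Complex.normSq ζ < 1 := by
    rw [Complex.normSq_eq_norm_sq]
    nlinarith [norm_nonneg ζ]
  rw [Complex.div_re, ← add_div, le_div_iff₀ hpos]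
  simp only [Complex.normSq_apply, Complex.sub_re, Complex.sub_im] at *
  nlinarith

theorem half_natDegree_le_re (hroots : ∀ z, H.IsRoot z → ‖z‖ < 1) {z : ℂ} (hz : ‖z‖ = 1) :
    (H.natDegree : ℝ) / 2 ≤ (z * (H.derivative.eval z / H.eval z)).re := by
  have hne : H.eval z ≠ 0 := fun h => (hroots z h).ne hz
  have hs := IsAlgClosed.splits H
  rw [hs.eval_derivative_div_eval_of_ne_zero hne, hs.natDegree_eq_card_roots]
  have key : ∀ s : Multiset ℂ, (∀ ζ ∈ s, ‖ζ‖ < 1) →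
      (Multiset.card s : ℝ) / 2 ≤ (z * (s.map fun ζ => 1 / (z - ζ)).sum).re := by
    intro s
    induction s using Multiset.induction_on with
    | empty => simp
    | cons ζ s ih =>
      intro h
      have h1 := ih fun w hw => h w (Multiset.mem_cons_of_mem hw)
      have h2 := half_le_re_div_sub hz (h ζ (Multiset.mem_cons_self ζ s))
      rw [Multiset.map_cons, Multiset.sum_cons, Multiset.card_cons, mul_add, Complex.add_re,
        mul_one_div]
      push_cast
      linarith
  exact key _ fun ζ hζ => hroots ζ (isRoot_of_mem_roots hζ)

theorem recip_X_mul_add (hm : H.natDegree ≤ m) {τ : ℂ} (hτ : ‖τ‖ = 1) :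
    X * H + C τ * recip m H = C τ * recip (m + 1) (X * H + C τ * recip m H) := by
  have h2 : recip (m + 1) (recip m H) = X * H := by
    rw [← recip_X_mul hm, recip_recip]
  have h3 : τ * conj τ = 1 := by
    rw [Complex.mul_conj, Complex.normSq_eq_norm_sq, hτ]; simp
  rw [recip_add, recip_C_mul, recip_X_mul hm, h2, mul_add, ← mul_assoc, ← C_mul, h3, C_1, one_mul,
    add_comm]

theorem monic_X_mul_add (hH : H.Monic) (hm : H.natDegree = m) (τ : ℂ) :
    (X * H + C τ * recip m H).Monic ∧ (X * H + C τ * recip m H).natDegree = m + 1 := by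
  have h1 : (X * H).Monic := monic_X.mul hH
  have h2 : (X * H).natDegree = m + 1 := by
    rw [natDegree_X_mul hH.ne_zero, hm]
  have h3 : (C τ * recip m H).natDegree < (X * H).natDegree := by
    rw [h2]
    exact Nat.lt_succ_of_le ((natDegree_C_mul_le _ _).trans (natDegree_recip_le hm.le))
  have h4 := degree_lt_degree h3
  exact ⟨h1.add_of_left h4, by rw [natDegree_add_eq_left_of_natDegree_lt h3, h2]⟩

/-- For |z| > 1 the first term dominates: |zH| > |H| ≥ |H^*|. -/
theorem norm_le_one_of_isRoot (hH : H.Monic) (hm : H.natDegree = m)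
    (hroots : ∀ z, H.IsRoot z → ‖z‖ < 1) {τ : ℂ} (hτ : ‖τ‖ = 1) {z : ℂ}
    (hz : (X * H + C τ * recip m H).IsRoot z) : ‖z‖ ≤ 1 := by
  by_contra! h
  have h1 := norm_eval_recip_le hH hm hroots h.le
  have h2 : 0 < ‖H.eval z‖ := by
    rw [norm_pos_iff]
    exact fun h0 => lt_asymm h (hroots z h0)
  have h3 : z * H.eval z = -(τ * (recip m H).eval z) := by
    rw [IsRoot.def, eval_add, eval_mul, eval_mul, eval_X, eval_C] at hz
    exact eq_neg_of_add_eq_zero_left hz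
  have h4 := congrArg norm h3
  rw [norm_neg, norm_mul, norm_mul, hτ, one_mul] at h4
  nlinarith

/-- By invariance the zeros are symmetric under z ↦ 1/conj z, so having none outside the closed disk
puts them all on the circle. At a double zero, w = zH'/H would satisfy 1 + 2 Re w = m, while the
logarithmic derivative gives Re w ≥ m/2. -/
theorem allZerosSimpleOnCircle_X_mul_add (hH : H.Monic) (hm : H.natDegree = m)
    (hroots : ∀ z, H.IsRoot z → ‖z‖ < 1) {τ : ℂ} (hτ : ‖τ‖ = 1) :
    AllZerosSimpleOnCircle (X * H + C τ * recip m H) := by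
  intro z hz
  obtain ⟨hmon, hdeg⟩ := monic_X_mul_add hH hm τ
  have hle := norm_le_one_of_isRoot hH hm hroots hτ hz
  have hτ0 : τ ≠ 0 := by rintro rfl; simp at hτ
  have hz0 : z ≠ 0 := by
    rintro rfl
    rw [IsRoot.def, eval_add, eval_mul, eval_mul, eval_X, eval_C, ← coeff_zero_eq_eval_zero
      (recip m H), coeff_zero_recip hH hm] at hz
    simp [hτ0] at hz
  have hge : 1 ≤ ‖z‖ := by
    have h1 : (X * H + C τ * recip m H).IsRoot (conj z)⁻¹ := by
      have h2 := hz
      rw [IsRoot.def, recip_X_mul_add hm.le hτ, eval_mul, eval_recip hdeg.le hz0, eval_C, mul_eq_zero,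
        mul_eq_zero, or_iff_right hτ0, or_iff_right (pow_ne_zero _ hz0),
        _root_.map_eq_zero] at h2
      exact h2
    have h2 := norm_le_one_of_isRoot hH hm hroots hτ h1
    rw [norm_inv, Complex.norm_conj] at h2
    exact (inv_le_one₀ (norm_pos_iff.2 hz0)).1 h2
  have hz1 : ‖z‖ = 1 := le_antisymm hle hge
  refine ⟨hz1, le_antisymm ?_ ((rootMultiplicity_pos hmon.ne_zero).2 hz)⟩
  by_contra! hmult
  have hder := ((one_lt_rootMultiplicity_iff_isRoot hmon.ne_zero).1 hmult).2
  have hne : H.eval z ≠ 0 := fun h => (hroots z h).ne hz1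
  have hre := half_natDegree_le_re hroots hz1
  rw [hm] at hre
  have e1 : z * H.eval z + τ * (z ^ m * conj (H.eval z)) = 0 := by
    rw [← eval_recip_of_norm_one hm.le hz1]
    simpa using hz
  have e2 : H.eval z + z * H.derivative.eval z + τ * (recip m H).derivative.eval z = 0 := by
    simpa using hder
  have e3 : z * (recip m H).derivative.eval z =
      z ^ m * conj (m * H.eval z - z * H.derivative.eval z) := by
    have h1 : (C (m : ℂ) * H - X * derivative H).natDegree ≤ m := by
      refine (natDegree_sub_le _ _).trans (max_le ((natDegree_C_mul_le _ _).trans hm.le) ?_)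
      rw [natDegree_le_iff_coeff_eq_zero]
      intro k hk
      obtain ⟨k, rfl⟩ := Nat.exists_eq_succ_of_ne_zero (by omega : k ≠ 0)
      rw [coeff_X_mul, coeff_derivative, coeff_eq_zero_of_natDegree_lt (hm ▸ hk), zero_mul]
    have h2 := congrArg (eval z) (X_mul_derivative_recip hm.le)
    rw [eval_recip_of_norm_one h1 hz1] at h2
    simpa using h2
  set w := z * (H.derivative.eval z / H.eval z) with hw
  have hD : z * H.derivative.eval z = w * H.eval z := by rw [hw]; field_simp
  have hc : conj (H.eval z) ≠ 0 := (_root_.map_ne_zero _).2 hne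
  -- Multiply the derivative equation `e2` by z and use `e1` to replace τ z^m conj H(z) by -zH(z).
  have e4 : z * H.eval z * (1 + w - (m - conj w)) = 0 := by
    have h1 : z * (H.eval z + z * H.derivative.eval z) +
        τ * (z * (recip m H).derivative.eval z) = 0 := by
      linear_combination z * e2
    rw [e3, hD] at h1
    simp only [map_sub, map_mul, map_natCast] at h1
    linear_combination h1 - (m - conj w) * e1
  have e5 := (mul_eq_zero.1 e4).resolve_left (mul_ne_zero hz0 hne)
  have e6 := congrArg Complex.re e5
  simp at e6
  linarith

end Zeros

/-! ### The Schur recursion and the Schur–Cohn test -/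

section Schur

/-- `RatFunc.eval` uses the reduced fraction; its denominator divides D, so it does not vanish at 0
either. -/
theorem valZero_div {P D : ℂ[X]} (hD : D.eval 0 ≠ 0) :
    valZero (algebraMap ℂ[X] (RatFunc ℂ) P / algebraMap ℂ[X] (RatFunc ℂ) D) =
      P.eval 0 / D.eval 0 := by
  have hD0 : D ≠ 0 := by rintro rfl; simp at hD
  set s := algebraMap ℂ[X] (RatFunc ℂ) P / algebraMap ℂ[X] (RatFunc ℂ) D with hs
  have h1 := congrArg (eval 0) ((RatFunc.num_mul_eq_mul_denom_iff hD0).2 hs)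
  obtain ⟨E, hE⟩ := RatFunc.denom_div_dvd P D
  rw [← hs] at hE
  have h2 : s.denom.eval 0 ≠ 0 := by
    intro h
    rw [hE, eval_mul, h, zero_mul] at hD
    exact hD rfl
  rw [eval_mul, eval_mul] at h1
  rw [valZero, RatFunc.eval, eval₂_id, eval₂_id, div_eq_div_iff h2 hD, h1]

/-- This is the inverse Szegő recursion: with a = P(0), take A = (P - aP^*) / (z(1-|a|²)). The
constant 1-|a|² is real, hence cancels in A/A^*. -/
theorem exists_schurStep {ℓ : ℕ} {P : ℂ[X]} (hP : P.Monic) (hdeg : P.natDegree = ℓ + 1)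
    (ha : ‖P.eval 0‖ < 1) :
    ∃ A : ℂ[X], A.Monic ∧ A.natDegree = ℓ ∧ P = X * A + C (P.eval 0) * recip ℓ A ∧
      schurStep (algebraMap ℂ[X] (RatFunc ℂ) P / algebraMap ℂ[X] (RatFunc ℂ) (recip (ℓ + 1) P)) =
        algebraMap ℂ[X] (RatFunc ℂ) A / algebraMap ℂ[X] (RatFunc ℂ) (recip ℓ A) := by
  set a := P.eval 0 with haP
  set c : ℂ := 1 - a * conj a with hc
  have hcr : conj c = c := by simp [hc, mul_comm]
  have hc0 : c ≠ 0 := by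
    rw [hc, Complex.mul_conj, Complex.normSq_eq_norm_sq]
    have : (1 - ‖a‖ ^ 2 : ℝ) ≠ 0 := by nlinarith [norm_nonneg a]
    exact_mod_cast this
  have hR0 : (recip (ℓ + 1) P).eval 0 = 1 := by
    rw [← coeff_zero_eq_eval_zero, coeff_zero_recip hP hdeg]
  set N : ℂ[X] := P - C a * recip (ℓ + 1) P with hN
  set A₀ : ℂ[X] := N.divX with hA₀
  have hNX : N = X * A₀ := by
    have h0 : N.coeff 0 = 0 := by
      rw [coeff_zero_eq_eval_zero, hN, eval_sub, eval_mul, eval_C, hR0, mul_one, sub_self]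
    conv_lhs => rw [← divX_mul_X_add N, h0, C_0, add_zero, mul_comm]
  have hNdeg : N.natDegree ≤ ℓ + 1 :=
    (natDegree_sub_le _ _).trans (max_le hdeg.le
      ((natDegree_C_mul_le _ _).trans (natDegree_recip_le hdeg.le)))
  have hA₀deg : A₀.natDegree ≤ ℓ := by
    rw [hA₀, natDegree_divX_eq_natDegree_tsub_one]; omega
  have hA₀lead : A₀.coeff ℓ = c := by
    rw [hA₀, coeff_divX, hN, coeff_sub, coeff_C_mul, coeff_recip le_rfl, Nat.sub_self,
      coeff_zero_eq_eval_zero, ← haP, ← hdeg, hP.coeff_natDegree]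
  have hrec : recip ℓ A₀ = recip (ℓ + 1) P - C (conj a) * P := by
    rw [← recip_X_mul hA₀deg, ← hNX, hN, recip_sub, recip_C_mul, recip_recip]
  have hAlead : (C c⁻¹ * A₀).coeff ℓ = 1 := by
    rw [coeff_C_mul, hA₀lead, inv_mul_cancel₀ hc0]
  have hAdeg : (C c⁻¹ * A₀).natDegree ≤ ℓ := (natDegree_C_mul_le _ _).trans hA₀deg
  have hAmon : (C c⁻¹ * A₀).Monic := monic_of_natDegree_le_of_coeff_eq_one ℓ hAdeg hAlead
  have hrecA : recip ℓ (C c⁻¹ * A₀) = C c⁻¹ * recip ℓ A₀ := by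
    rw [recip_C_mul, map_inv₀, hcr]
  have hcc : C c⁻¹ * C c = (1 : ℂ[X]) := by rw [← C_mul, inv_mul_cancel₀ hc0, C_1]
  refine ⟨C c⁻¹ * A₀, hAmon, le_antisymm hAdeg (le_natDegree_of_ne_zero (by simp [hAlead])), ?_, ?_⟩
  · have h1 : C c * P = X * A₀ + C a * recip ℓ A₀ := by
      rw [hrec, ← hNX, hN, hc, C_sub, C_mul, C_1]; ring
    rw [hrecA]
    linear_combination C c⁻¹ * h1 - P * hcc
  · have hA₀0 : A₀ ≠ 0 := by
      intro h
      rw [h, coeff_zero] at hA₀lead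
      exact hc0 hA₀lead.symm
    have n1 : algebraMap ℂ[X] (RatFunc ℂ) (recip (ℓ + 1) P) ≠ 0 :=
      RatFunc.algebraMap_ne_zero (recip_ne_zero hP.ne_zero)
    have n2 : algebraMap ℂ[X] (RatFunc ℂ) (recip ℓ A₀) ≠ 0 :=
      RatFunc.algebraMap_ne_zero (recip_ne_zero hA₀0)
    have n3 : RatFunc.C c⁻¹ ≠ (0 : RatFunc ℂ) := by simpa using hc0
    have e1 : algebraMap ℂ[X] (RatFunc ℂ) P - RatFunc.C a *
        algebraMap ℂ[X] (RatFunc ℂ) (recip (ℓ + 1) P) =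
        RatFunc.X * algebraMap ℂ[X] (RatFunc ℂ) A₀ := by
      rw [← RatFunc.algebraMap_C, ← RatFunc.algebraMap_X, ← map_mul, ← map_mul, ← map_sub, ← hNX]
    have e2 : algebraMap ℂ[X] (RatFunc ℂ) (recip (ℓ + 1) P) - RatFunc.C (conj a) *
        algebraMap ℂ[X] (RatFunc ℂ) P = algebraMap ℂ[X] (RatFunc ℂ) (recip ℓ A₀) := by
      rw [← RatFunc.algebraMap_C, ← map_mul, ← map_sub, ← hrec]
    rw [schurStep, valZero_div (by rw [hR0]; exact one_ne_zero), hR0, div_one, ← haP, hrecA,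
      map_mul, map_mul, RatFunc.algebraMap_C, mul_div_mul_left _ _ n3]
    have e3 : algebraMap ℂ[X] (RatFunc ℂ) P / algebraMap ℂ[X] (RatFunc ℂ) (recip (ℓ + 1) P) -
        RatFunc.C a = RatFunc.X * algebraMap ℂ[X] (RatFunc ℂ) A₀ /
          algebraMap ℂ[X] (RatFunc ℂ) (recip (ℓ + 1) P) := by
      rw [← e1, sub_div, mul_div_cancel_right₀ _ n1]
    have e4 : 1 - RatFunc.C (conj a) * (algebraMap ℂ[X] (RatFunc ℂ) P /
        algebraMap ℂ[X] (RatFunc ℂ) (recip (ℓ + 1) P)) =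
        algebraMap ℂ[X] (RatFunc ℂ) (recip ℓ A₀) /
          algebraMap ℂ[X] (RatFunc ℂ) (recip (ℓ + 1) P) := by
      rw [← e2, sub_div, div_self n1, mul_div_assoc]
    rw [e3, e4, div_div_div_cancel_right₀ n1, mul_div_assoc, inv_mul_cancel_left₀ RatFunc.X_ne_zero]

/-- Induction along P = zA + aA^* with |a| < 1: if A has its zeros in the disk, then |zA| ≥ |A| ≥
|A^*| and A ≠ 0 for |z| ≥ 1, so P cannot vanish there. -/
theorem norm_lt_one_of_schurCohn {ℓ : ℕ} {P : ℂ[X]} (hP : P.Monic) (hdeg : P.natDegree = ℓ)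
    (h : SchurCohn ℓ P) (z : ℂ) (hz : P.IsRoot z) : ‖z‖ < 1 := by
  induction ℓ generalizing P z with
  | zero =>
    rw [hP.natDegree_eq_zero.1 hdeg] at hz
    simp at hz
  | succ ℓ ih =>
    have hR0 : (recip (ℓ + 1) P).eval 0 = 1 := by
      rw [← coeff_zero_eq_eval_zero, coeff_zero_recip hP hdeg]
    have ha : ‖P.eval 0‖ < 1 := by
      have := h (ℓ + 1) (by omega) le_rfl
      rw [schurFun, Nat.sub_self, Function.iterate_zero, id, valZero_div (by simp [hR0]), hR0,
        div_one] at this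
      exact this
    obtain ⟨A, hA, hAdeg, hPA, hstep⟩ := exists_schurStep hP hdeg ha
    have hAS : SchurCohn ℓ A := by
      intro k hk hkl
      have := h k hk (by omega)
      rw [schurFun, Nat.succ_sub hkl, Function.iterate_succ_apply, hstep] at this
      exact this
    have hAroot := ih hA hAdeg hAS
    by_contra! hz1
    have h1 := norm_eval_recip_le hA hAdeg hAroot hz1
    have h2 : 0 < ‖A.eval z‖ := norm_pos_iff.2 fun h0 => (hAroot z h0).not_ge hz1
    have h3 : z * A.eval z = -(P.eval 0 * (recip ℓ A).eval z) := by
      rw [IsRoot.def] at hz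
      have e := congrArg (eval z) hPA
      rw [hz, eval_add, eval_mul, eval_mul, eval_X, eval_C] at e
      exact eq_neg_of_add_eq_zero_left e.symm
    have h4 := congrArg norm h3
    rw [norm_neg, norm_mul, norm_mul] at h4
    nlinarith [norm_nonneg (P.eval 0), norm_nonneg ((recip ℓ A).eval z)]

end Schur

open MeasureTheory

/-! ### The inner product of L²(μ) on polynomials -/

section InnerProduct

variable {μ : Measure ℂ}

theorem ae_norm_eq_one (hμ : μ.support = Metric.sphere (0 : ℂ) 1) : ∀ᵐ z ∂μ, ‖z‖ = 1 := by
  have h : μ.support ∈ ae μ := Measure.support_mem_ae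
  rw [hμ] at h
  filter_upwards [h] with z hz
  simpa using hz

theorem integrable_eval_mul_conj [IsFiniteMeasure μ] (hμ : μ.support = Metric.sphere (0 : ℂ) 1) (P Q : ℂ[X]) :
    Integrable (fun z => P.eval z * conj (Q.eval z)) μ := by
  have hc : Continuous fun z => P.eval z * conj (Q.eval z) :=
    P.continuous.mul (Complex.continuous_conj.comp Q.continuous)
  obtain ⟨B, hB⟩ := (isCompact_sphere (0 : ℂ) 1).exists_bound_of_continuousOn hc.continuousOn
  refine Integrable.of_bound hc.aestronglyMeasurable B ?_
  filter_upwards [ae_norm_eq_one hμ] with z hz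
  exact hB z (by simpa using hz)

theorem ip_congr (hμ : μ.support = Metric.sphere (0 : ℂ) 1) {P Q P' Q' : ℂ[X]}
    (h : ∀ z : ℂ, ‖z‖ = 1 → P.eval z * conj (Q.eval z) = P'.eval z * conj (Q'.eval z)) :
    ip μ P Q = ip μ P' Q' := by
  refine integral_congr_ae ?_
  filter_upwards [ae_norm_eq_one hμ] with z hz using h z hz

theorem conj_ip (P Q : ℂ[X]) : conj (ip μ P Q) = ip μ Q P := by
  rw [ip, ip, ← integral_conj]
  simp [mul_comm]

theorem ip_add_left [IsFiniteMeasure μ] (hμ : μ.support = Metric.sphere (0 : ℂ) 1) (P Q R : ℂ[X]) :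
    ip μ (P + Q) R = ip μ P R + ip μ Q R := by
  rw [ip, ip, ip, ← integral_add (integrable_eval_mul_conj hμ _ _)
    (integrable_eval_mul_conj hμ _ _)]
  simp [add_mul]

theorem ip_C_mul_left (c : ℂ) (P R : ℂ[X]) : ip μ (C c * P) R = c * ip μ P R := by
  rw [ip, ip, ← integral_const_mul]
  simp [mul_assoc]

theorem ip_zero_left (R : ℂ[X]) : ip μ 0 R = 0 := by simp [ip]

theorem ip_sub_left [IsFiniteMeasure μ] (hμ : μ.support = Metric.sphere (0 : ℂ) 1) (P Q R : ℂ[X]) :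
    ip μ (P - Q) R = ip μ P R - ip μ Q R := by
  rw [ip, ip, ip, ← integral_sub (integrable_eval_mul_conj hμ _ _)
    (integrable_eval_mul_conj hμ _ _)]
  simp [sub_mul]

theorem ip_sum_left [IsFiniteMeasure μ] (hμ : μ.support = Metric.sphere (0 : ℂ) 1) {ι : Type*} (s : Finset ι)
    (P : ι → ℂ[X]) (R : ℂ[X]) : ip μ (∑ i ∈ s, P i) R = ∑ i ∈ s, ip μ (P i) R := by
  classical
  induction s using Finset.induction_on with
  | empty => simp [ip_zero_left]
  | insert a s ha ih => rw [Finset.sum_insert ha, Finset.sum_insert ha, ip_add_left hμ, ih]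

theorem ip_add_right [IsFiniteMeasure μ] (hμ : μ.support = Metric.sphere (0 : ℂ) 1) (P Q R : ℂ[X]) :
    ip μ R (P + Q) = ip μ R P + ip μ R Q := by
  rw [← conj_ip, ip_add_left hμ, map_add, conj_ip, conj_ip]

theorem ip_C_mul_right (c : ℂ) (P R : ℂ[X]) : ip μ R (C c * P) = conj c * ip μ R P := by
  rw [← conj_ip, ip_C_mul_left, map_mul, conj_ip]

theorem ip_zero_right (R : ℂ[X]) : ip μ R 0 = 0 := by simp [ip]

theorem ip_sum_right [IsFiniteMeasure μ] (hμ : μ.support = Metric.sphere (0 : ℂ) 1) {ι : Type*} (s : Finset ι)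
    (P : ι → ℂ[X]) (R : ℂ[X]) : ip μ R (∑ i ∈ s, P i) = ∑ i ∈ s, ip μ R (P i) := by
  rw [← conj_ip, ip_sum_left hμ, map_sum]
  simp [conj_ip]

theorem ip_X_mul_X_mul (hμ : μ.support = Metric.sphere (0 : ℂ) 1) (P Q : ℂ[X]) :
    ip μ (X * P) (X * Q) = ip μ P Q := by
  refine ip_congr hμ fun z hz => ?_
  have h : z * conj z = 1 := by
    rw [Complex.mul_conj, Complex.normSq_eq_norm_sq, hz]; simp
  rw [eval_mul, eval_mul, eval_X, map_mul]
  linear_combination (P.eval z * conj (Q.eval z)) * h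

theorem ip_self (P : ℂ[X]) : ip μ P P = ((∫ z, ‖P.eval z‖ ^ 2 ∂μ : ℝ) : ℂ) := by
  rw [ip, ← integral_complex_ofReal]
  simp [Complex.mul_conj, Complex.normSq_eq_norm_sq]

/-- A polynomial that vanishes almost everywhere vanishes on the support, since its zero set is
closed; the circle is infinite. -/
theorem eq_zero_of_ip_self [IsFiniteMeasure μ] (hμ : μ.support = Metric.sphere (0 : ℂ) 1) {P : ℂ[X]}
    (h : ip μ P P = 0) : P = 0 := by
  rw [ip_self, Complex.ofReal_eq_zero] at h
  have hi : Integrable (fun z => ‖P.eval z‖ ^ 2) μ := by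
    have := (integrable_eval_mul_conj hμ P P).norm
    simpa [pow_two] using this
  rw [integral_eq_zero_iff_of_nonneg (fun z => by positivity) hi] at h
  have hcl : IsClosed {z : ℂ | P.eval z = 0} := isClosed_eq P.continuous continuous_const
  have hsub : μ.support ⊆ {z : ℂ | P.eval z = 0} := by
    refine Measure.support_subset_of_isClosed hcl ?_
    filter_upwards [h] with z hz
    simpa using hz
  by_contra hP
  have hfin : (Metric.sphere (0 : ℂ) 1).Finite := by
    rw [← hμ]
    refine (P.roots.toFinset.finite_toSet).subset fun z hz => ?_
    simpa [hP] using hsub hz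
  have hinf : (Metric.sphere (0 : ℂ) 1).Infinite := by
    refine (isPreconnected_sphere (by simp [Complex.rank_real_complex]) 0 1).infinite_of_nontrivial
      ⟨1, by simp, -1, by simp, ?_⟩
    intro h
    have := congrArg Complex.re h
    norm_num at this
  exact hinf hfin

theorem ip_self_ne_zero [IsFiniteMeasure μ] (hμ : μ.support = Metric.sphere (0 : ℂ) 1) {P : ℂ[X]} (hP : P ≠ 0) :
    ip μ P P ≠ 0 := fun h => hP (eq_zero_of_ip_self hμ h)

end InnerProduct

/-! ### Orthogonality and zeros of the Szegő polynomials -/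

section Opuc

variable {μ : Measure ℂ}

theorem X_pow_eq_opuc_add (μ : Measure ℂ) (n : ℕ) :
    (X : ℂ[X]) ^ n = opuc μ n +
      ∑ k : Fin n, C (ip μ (X ^ n) (opuc μ k) / ip μ (opuc μ k) (opuc μ k)) * opuc μ k := by
  conv_rhs => rw [opuc]
  rw [sub_add_cancel]

theorem monic_natDegree_opuc (μ : Measure ℂ) (n : ℕ) :
    (opuc μ n).Monic ∧ (opuc μ n).natDegree = n := by
  induction n using Nat.strong_induction_on with
  | _ n ih =>
    have hlt : (∑ k : Fin n, C (ip μ (X ^ n) (opuc μ k) / ip μ (opuc μ k) (opuc μ k)) *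
        opuc μ k).degree < (n : WithBot ℕ) := by
      refine (degree_sum_le _ _).trans_lt ((Finset.sup_lt_iff (WithBot.bot_lt_coe n)).2 ?_)
      intro k _
      refine ((smul_eq_C_mul (p := opuc μ k) _ ▸ degree_smul_le _ _)).trans_lt ?_
      obtain ⟨h1, h2⟩ := ih k k.2
      rw [degree_eq_natDegree h1.ne_zero, h2]
      exact WithBot.coe_lt_coe.2 k.2
    rw [opuc]
    exact ⟨monic_X_pow_sub hlt, natDegree_eq_of_degree_eq_some (by
      rw [degree_sub_eq_left_of_degree_lt (by rwa [degree_X_pow]), degree_X_pow])⟩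

theorem monic_opuc (μ : Measure ℂ) (n : ℕ) : (opuc μ n).Monic := (monic_natDegree_opuc μ n).1

theorem natDegree_opuc (μ : Measure ℂ) (n : ℕ) : (opuc μ n).natDegree = n :=
  (monic_natDegree_opuc μ n).2

variable [IsFiniteMeasure μ]

theorem ip_opuc_opuc (hμ : μ.support = Metric.sphere (0 : ℂ) 1) {n k : ℕ} (hk : k < n) :
    ip μ (opuc μ n) (opuc μ k) = 0 := by
  induction n using Nat.strong_induction_on generalizing k with
  | _ n ih =>
    rw [opuc, ip_sub_left hμ, ip_sum_left hμ, Finset.sum_eq_single (⟨k, hk⟩ : Fin n)]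
    · rw [ip_C_mul_left, div_mul_cancel₀ _ (ip_self_ne_zero hμ (monic_opuc μ k).ne_zero), sub_self]
    · intro j _ hj
      rw [ip_C_mul_left, mul_eq_zero]
      right
      rcases lt_trichotomy (j : ℕ) k with h | h | h
      · rw [← conj_ip, ih k hk h, map_zero]
      · exact absurd (Fin.ext h) hj
      · rw [ih j j.2 h]
    · intro h
      exact absurd (Finset.mem_univ _) h

theorem ip_opuc_X_pow (hμ : μ.support = Metric.sphere (0 : ℂ) 1) {n k : ℕ} (hk : k < n) :
    ip μ (opuc μ n) (X ^ k) = 0 := by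
  rw [X_pow_eq_opuc_add μ k, ip_add_right hμ, ip_opuc_opuc hμ hk, ip_sum_right hμ, zero_add]
  refine Finset.sum_eq_zero fun j _ => ?_
  rw [ip_C_mul_right, ip_opuc_opuc hμ (j.2.trans hk), mul_zero]

theorem ip_opuc_of_natDegree_lt (hμ : μ.support = Metric.sphere (0 : ℂ) 1) {n : ℕ} {R : ℂ[X]}
    (hR : R.natDegree < n) : ip μ (opuc μ n) R = 0 := by
  rw [R.as_sum_range_C_mul_X_pow, ip_sum_right hμ]
  refine Finset.sum_eq_zero fun k hk => ?_
  rw [ip_C_mul_right, ip_opuc_X_pow hμ (by rw [Finset.mem_range] at hk; omega), mul_zero]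

/-- Let ζ be the zero and ρ = (z-ζ)q. Since zq = ρ + ζq with ρ ⊥ q, Pythagoras gives ‖q‖² = ‖ρ‖² +
|ζ|²‖q‖², hence |ζ| < 1. -/
theorem norm_lt_one_of_isRoot_opuc (hμ : μ.support = Metric.sphere (0 : ℂ) 1) {n : ℕ} {z : ℂ}
    (hz : (opuc μ n).IsRoot z) : ‖z‖ < 1 := by
  obtain ⟨q, hq⟩ := dvd_iff_isRoot.2 hz
  have hρ := (monic_opuc μ n).ne_zero
  have hq0 : q ≠ 0 := by
    rintro rfl
    rw [mul_zero] at hq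
    exact hρ hq
  have hdeg : q.natDegree < n := by
    have := congrArg natDegree hq
    rw [natDegree_opuc, natDegree_mul (X_sub_C_ne_zero z) hq0, natDegree_X_sub_C] at this
    omega
  have h0 := ip_opuc_of_natDegree_lt hμ hdeg
  have h0' : ip μ q (opuc μ n) = 0 := by rw [← conj_ip, h0, map_zero]
  have h1 : X * q = opuc μ n + C z * q := by rw [hq]; ring
  have h2 : ip μ q q = ip μ (opuc μ n) (opuc μ n) + z * conj z * ip μ q q := by
    have e := ip_X_mul_X_mul hμ q q
    rw [h1] at e
    simp only [ip_add_left hμ, ip_add_right hμ, ip_C_mul_left, ip_C_mul_right, h0, h0'] at e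
    linear_combination -e
  rw [Complex.mul_conj, Complex.normSq_eq_norm_sq] at h2
  have p1 := ip_self_ne_zero hμ hρ
  have p2 := ip_self_ne_zero hμ hq0
  rw [ip_self] at p1 p2
  rw [ip_self, ip_self] at h2
  have h3 : (∫ w, ‖q.eval w‖ ^ 2 ∂μ) =
      (∫ w, ‖(opuc μ n).eval w‖ ^ 2 ∂μ) + ‖z‖ ^ 2 * ∫ w, ‖q.eval w‖ ^ 2 ∂μ := by
    exact_mod_cast h2
  have q1 : 0 < ∫ w, ‖(opuc μ n).eval w‖ ^ 2 ∂μ :=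
    lt_of_le_of_ne (integral_nonneg fun _ => by positivity) (by exact_mod_cast p1.symm)
  have q2 : 0 < ∫ w, ‖q.eval w‖ ^ 2 ∂μ :=
    lt_of_le_of_ne (integral_nonneg fun _ => by positivity) (by exact_mod_cast p2.symm)
  by_contra! h
  have h4 : 1 ≤ ‖z‖ ^ 2 := one_le_pow₀ h
  nlinarith

theorem eval_recip_opuc_ne_zero (hμ : μ.support = Metric.sphere (0 : ℂ) 1) {m : ℕ} {z : ℂ}
    (hz : ‖z‖ ≤ 1) : (recip m (opuc μ m)).eval z ≠ 0 := by
  rcases eq_or_ne z 0 with rfl | h0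
  · rw [← coeff_zero_eq_eval_zero, coeff_zero_recip (monic_opuc μ m) (natDegree_opuc μ m)]
    exact one_ne_zero
  · rw [eval_recip (natDegree_opuc μ m).le h0]
    refine mul_ne_zero (pow_ne_zero _ h0) ((_root_.map_ne_zero _).2 fun h => ?_)
    have h1 := norm_lt_one_of_isRoot_opuc hμ h
    rw [norm_inv, Complex.norm_conj] at h1
    exact h1.not_ge ((one_le_inv₀ (norm_pos_iff.2 h0)).2 hz)

/-- On the circle zA can be moved to the second argument, where it turns z^k into z^(k-1-ℓ) A^*, of
degree at most k-1 < m. -/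
theorem ip_X_mul_mul_opuc (hμ : μ.support = Metric.sphere (0 : ℂ) 1) {ℓ m k : ℕ} {A : ℂ[X]}
    (hA : A.natDegree ≤ ℓ) (hk : ℓ + 1 ≤ k) (hkm : k ≤ m) :
    ip μ (X * A * opuc μ m) (X ^ k) = 0 := by
  have hdeg : (X ^ (k - 1 - ℓ) * recip ℓ A).natDegree < m := by
    have h1 := natDegree_mul_le (p := (X : ℂ[X]) ^ (k - 1 - ℓ)) (q := recip ℓ A)
    rw [natDegree_X_pow] at h1
    have := natDegree_recip_le hA
    omega
  rw [← ip_opuc_of_natDegree_lt hμ hdeg]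
  refine ip_congr hμ fun z hz => ?_
  have h : z * conj z = 1 := by
    rw [Complex.mul_conj, Complex.normSq_eq_norm_sq, hz]; simp
  obtain ⟨i, rfl⟩ := Nat.exists_eq_add_of_le hk
  rw [show ℓ + 1 + i - 1 - ℓ = i by omega]
  simp only [eval_mul, eval_pow, eval_X, map_mul, map_pow, eval_recip_of_norm_one hA hz,
    Complex.conj_conj]
  rw [pow_add, pow_succ]
  linear_combination (A.eval z * (opuc μ m).eval z * conj z ^ ℓ * conj z ^ i) * h

/-- Since ρ_m^* = z^m conj ρ_m on the circle, the product is ⟨B z^(m-k), ρ_m⟩, with first argument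
of degree at most ℓ+m-k < m. -/
theorem ip_mul_recip_opuc (hμ : μ.support = Metric.sphere (0 : ℂ) 1) {ℓ m k : ℕ} {B : ℂ[X]}
    (hB : B.natDegree ≤ ℓ) (hk : ℓ + 1 ≤ k) (hkm : k ≤ m) :
    ip μ (B * recip m (opuc μ m)) (X ^ k) = 0 := by
  have hdeg : (B * X ^ (m - k)).natDegree < m := by
    have h1 := natDegree_mul_le (p := B) (q := (X : ℂ[X]) ^ (m - k))
    rw [natDegree_X_pow] at h1
    omega
  have h0 := ip_opuc_of_natDegree_lt hμ hdeg
  rw [← map_eq_zero_iff (starRingEnd ℂ) (starRingEnd ℂ).injective, conj_ip] at h0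
  rw [← h0]
  refine ip_congr hμ fun z hz => ?_
  have h : z ^ k * conj z ^ k = 1 := by
    rw [← mul_pow, Complex.mul_conj, Complex.normSq_eq_norm_sq, hz]; simp
  obtain ⟨i, rfl⟩ := Nat.exists_eq_add_of_le hkm
  simp only [eval_mul, eval_pow, eval_X, map_pow,
    eval_recip_of_norm_one (natDegree_opuc μ (k + i)).le hz, Nat.add_sub_cancel_left]
  rw [pow_add]
  linear_combination (B.eval z * z ^ i * conj ((opuc μ (k + i)).eval z)) * h

theorem ip_eq_zero_of_mem_testSpace (hμ : μ.support = Metric.sphere (0 : ℂ) 1) {n ℓ : ℕ}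
    {Q R : ℂ[X]} (h : ∀ k, ℓ + 1 ≤ k → k ≤ n - ℓ - 1 → ip μ Q (X ^ k) = 0)
    (hR : R ∈ testSpace n ℓ) : ip μ Q R = 0 := by
  induction hR using Submodule.span_induction with
  | mem x hx =>
    obtain ⟨k, hk, rfl⟩ := hx
    exact h k hk.1 hk.2
  | zero => exact ip_zero_right Q
  | add x y _ _ hx hy => rw [ip_add_right hμ, hx, hy, add_zero]
  | smul c x _ hx => rw [smul_eq_C_mul, ip_C_mul_right, hx, mul_zero]

theorem ip_mul_opuc_add_of_mem_testSpace (hμ : μ.support = Metric.sphere (0 : ℂ) 1) {n ℓ : ℕ}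
    {A B R : ℂ[X]} (hA : A.natDegree ≤ ℓ) (hB : B.natDegree ≤ ℓ) (hR : R ∈ testSpace n ℓ) :
    ip μ (X * A * opuc μ (n - ℓ - 1) + B * recip (n - ℓ - 1) (opuc μ (n - ℓ - 1))) R = 0 := by
  refine ip_eq_zero_of_mem_testSpace hμ (fun k hk hkm => ?_) hR
  rw [ip_add_left hμ, ip_X_mul_mul_opuc hμ hA hk hkm, ip_mul_recip_opuc hμ hB hk hkm, add_zero]

end Opuc

/-! ### Polynomials orthogonal to the test space -/

section Representation

variable {μ : Measure ℂ} [IsFiniteMeasure μ]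

theorem isCoprime_X_mul_opuc (hμ : μ.support = Metric.sphere (0 : ℂ) 1) (m : ℕ) :
    IsCoprime (X * opuc μ m) (recip m (opuc μ m)) := by
  rw [isCoprime_iff_aeval_ne_zero_of_isAlgClosed ℂ ℂ]
  intro z
  by_cases h : (X * opuc μ m).IsRoot z
  · right
    rw [coe_aeval_eq_eval]
    refine eval_recip_opuc_ne_zero hμ ?_
    rw [IsRoot.def, eval_mul, eval_X, mul_eq_zero] at h
    rcases h with rfl | h
    · simp
    · exact (norm_lt_one_of_isRoot_opuc hμ h).le
  · left
    rwa [coe_aeval_eq_eval]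

/-- By coprimality zρ_m divides B, but its degree m+1 exceeds ℓ. -/
theorem eq_zero_of_X_mul_mul_opuc_add (hμ : μ.support = Metric.sphere (0 : ℂ) 1) {ℓ m : ℕ}
    (hℓ : ℓ ≤ m) {A B : ℂ[X]} (hB : B.natDegree ≤ ℓ)
    (h : X * A * opuc μ m + B * recip m (opuc μ m) = 0) : A = 0 ∧ B = 0 := by
  have hX : X * opuc μ m ≠ 0 := mul_ne_zero X_ne_zero (monic_opuc μ m).ne_zero
  have hdvd : X * opuc μ m ∣ B * recip m (opuc μ m) :=
    ⟨-A, by linear_combination h⟩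
  have hB0 : B = 0 := by
    refine eq_zero_of_dvd_of_natDegree_lt
      ((isCoprime_X_mul_opuc hμ m).dvd_of_dvd_mul_right hdvd) ?_
    rw [natDegree_X_mul (monic_opuc μ m).ne_zero, natDegree_opuc]
    omega
  refine ⟨?_, hB0⟩
  rw [hB0, zero_mul, add_zero, mul_right_comm] at h
  exact (mul_eq_zero.1 h).resolve_left hX

theorem mem_degreeLT_succ {d : ℕ} {P : ℂ[X]} : P ∈ degreeLT ℂ (d + 1) ↔ P.natDegree ≤ d := by
  rw [mem_degreeLT, degree_lt_iff_coeff_zero, natDegree_le_iff_coeff_eq_zero]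
  rfl

theorem X_pow_mul_mem_testSpace {n ℓ : ℕ} {R : ℂ[X]} (hR : R ∈ degreeLT ℂ (n - ℓ - 1 - ℓ)) :
    X ^ (ℓ + 1) * R ∈ testSpace n ℓ := by
  rw [mem_degreeLT, degree_lt_iff_coeff_zero] at hR
  rw [R.as_sum_range_C_mul_X_pow, Finset.mul_sum]
  refine Submodule.sum_mem _ fun i _ => ?_
  rcases lt_or_ge i (n - ℓ - 1 - ℓ) with hi | hi
  · have : X ^ (ℓ + 1) * (C (R.coeff i) * X ^ i) = R.coeff i • (X : ℂ[X]) ^ (ℓ + 1 + i) := by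
      rw [smul_eq_C_mul, pow_add]; ring
    rw [this]
    exact Submodule.smul_mem _ _ (Submodule.subset_span ⟨ℓ + 1 + i, ⟨by omega, by omega⟩, rfl⟩)
  · rw [hR i hi]
    simp

theorem finrank_degreeLT (d : ℕ) : Module.finrank ℂ (degreeLT ℂ d) = d := by
  rw [(degreeLTEquiv ℂ d).finrank_eq, Module.finrank_fin_fun]

instance finiteDimensional_degreeLT (d : ℕ) : FiniteDimensional ℂ (degreeLT ℂ d) :=
  (degreeLTEquiv ℂ d).symm.finiteDimensional

/-- The map `(A, B, R) ↦ z A ρ_m + B ρ_m^* + z^{ℓ+1} R`. -/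
noncomputable def representationMap (μ : Measure ℂ) (ℓ m : ℕ) :
    (degreeLT ℂ (ℓ + 1) × degreeLT ℂ (ℓ + 1) × degreeLT ℂ (m - ℓ)) →ₗ[ℂ] ℂ[X] where
  toFun t := X * (t.1 : ℂ[X]) * opuc μ m + (t.2.1 : ℂ[X]) * recip m (opuc μ m) +
    X ^ (ℓ + 1) * (t.2.2 : ℂ[X])
  map_add' s t := by
    simp only [Prod.fst_add, Prod.snd_add, Submodule.coe_add]
    ring
  map_smul' c t := by
    simp only [Prod.smul_fst, Prod.smul_snd, Submodule.coe_smul, smul_eq_C_mul, RingHom.id_apply]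
    ring

/-- `representationMap` is a bijection onto the polynomials of degree at most n: dimensions agree,
2(ℓ+1) + (m-ℓ) = n+1, and it is injective because the term z^(ℓ+1) R is orthogonal to the other two.
Orthogonality of Q to the test space then kills that term. -/
theorem exists_eq_X_mul_mul_opuc_add (hμ : μ.support = Metric.sphere (0 : ℂ) 1) {n ℓ : ℕ}
    (hn : 2 * ℓ + 1 ≤ n) {Q : ℂ[X]} (hQ : Q.natDegree ≤ n)
    (horth : ∀ R ∈ testSpace n ℓ, ip μ Q R = 0) :
    ∃ A B : ℂ[X], A.natDegree ≤ ℓ ∧ B.natDegree ≤ ℓ ∧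
      Q = X * A * opuc μ (n - ℓ - 1) + B * recip (n - ℓ - 1) (opuc μ (n - ℓ - 1)) := by
  set m := n - ℓ - 1 with hm
  have hmem : ∀ t, representationMap μ ℓ m t ∈ degreeLT ℂ (n + 1) := by
    rintro ⟨⟨A, hA⟩, ⟨B, hB⟩, ⟨R, hR⟩⟩
    have hA' := mem_degreeLT_succ.1 hA
    have hB' := mem_degreeLT_succ.1 hB
    refine Submodule.add_mem _ (Submodule.add_mem _ ?_ ?_) ?_
    · rw [mem_degreeLT_succ]
      have h1 := natDegree_mul_le (p := X * A) (q := opuc μ m)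
      have h2 := natDegree_mul_le (p := X) (q := A)
      rw [natDegree_opuc] at h1
      rw [natDegree_X] at h2
      simp only
      omega
    · rw [mem_degreeLT_succ]
      have h1 := natDegree_mul_le (p := B) (q := recip m (opuc μ m))
      have h2 := natDegree_recip_le (natDegree_opuc μ m).le
      simp only
      omega
    · rw [mem_degreeLT, degree_lt_iff_coeff_zero] at hR ⊢
      intro k hk
      obtain ⟨i, rfl⟩ := Nat.exists_eq_add_of_le (show ℓ + 1 ≤ k by omega)
      simp only
      rw [add_comm (ℓ + 1) i, coeff_X_pow_mul]
      exact hR i (by omega)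
  let L := (representationMap μ ℓ m).codRestrict (degreeLT ℂ (n + 1)) hmem
  have hfin : Module.finrank ℂ (degreeLT ℂ (ℓ + 1) × degreeLT ℂ (ℓ + 1) × degreeLT ℂ (m - ℓ)) =
      Module.finrank ℂ (degreeLT ℂ (n + 1)) := by
    simp only [Module.finrank_prod, finrank_degreeLT]
    omega
  have hinj : Function.Injective L := by
    rw [← LinearMap.ker_eq_bot, LinearMap.ker_eq_bot']
    rintro ⟨⟨A, hA⟩, ⟨B, hB⟩, ⟨R, hR⟩⟩ h
    have h1 : X * A * opuc μ m + B * recip m (opuc μ m) + X ^ (ℓ + 1) * R = 0 :=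
      congrArg Subtype.val h
    have hA' := mem_degreeLT_succ.1 hA
    have hB' := mem_degreeLT_succ.1 hB
    have hT := X_pow_mul_mem_testSpace (n := n) hR
    have h2 := ip_mul_opuc_add_of_mem_testSpace hμ hA' hB' hT
    have h3 : ip μ (X ^ (ℓ + 1) * R) (X ^ (ℓ + 1) * R) = 0 := by
      have e := ip_add_left hμ (X * A * opuc μ m + B * recip m (opuc μ m)) (X ^ (ℓ + 1) * R)
        (X ^ (ℓ + 1) * R)
      rw [h1, ip_zero_left, h2, zero_add] at e
      exact e.symm
    have h4 := eq_zero_of_ip_self hμ h3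
    rw [h4, add_zero] at h1
    obtain ⟨rfl, rfl⟩ := eq_zero_of_X_mul_mul_opuc_add hμ (by omega) hB' h1
    have h5 : R = 0 := (mul_eq_zero.1 h4).resolve_left (pow_ne_zero _ X_ne_zero)
    subst h5
    rfl
  have hsurj := (LinearMap.injective_iff_surjective_of_finrank_eq_finrank hfin).1 hinj
  obtain ⟨⟨⟨A, hA⟩, ⟨B, hB⟩, ⟨R, hR⟩⟩, h⟩ := hsurj ⟨Q, mem_degreeLT_succ.2 hQ⟩
  have h1 : X * A * opuc μ m + B * recip m (opuc μ m) + X ^ (ℓ + 1) * R = Q :=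
    congrArg Subtype.val h
  have hA' := mem_degreeLT_succ.1 hA
  have hB' := mem_degreeLT_succ.1 hB
  have hT := X_pow_mul_mem_testSpace (n := n) hR
  have h2 := ip_mul_opuc_add_of_mem_testSpace hμ hA' hB' hT
  have h3 := horth _ hT
  rw [← h1, ip_add_left hμ, h2, zero_add] at h3
  exact ⟨A, B, hA', hB', by rw [← h1, eq_zero_of_ip_self hμ h3, add_zero]⟩

end Representation

open Matrix

/-! ### The block linear system and its determinants -/

section LinearAlgebra

variable {ℓ : ℕ}

/-- The index splitting `{0, …, 2ℓ} = {0, …, ℓ-1} ∪ {ℓ, …, 2ℓ}`. -/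
def rowEquiv (ℓ : ℕ) : Fin ℓ ⊕ Fin (ℓ + 1) ≃ Fin (2 * ℓ + 1) :=
  finSumFinEquiv.trans (finCongr (by omega))

/-- The block matrix whose determinant is `Delta`. -/
noncomputable def blockMatrix (α f : Fin (2 * ℓ + 1) → ℂ) :
    Matrix (Fin ℓ ⊕ Fin (ℓ + 1)) (Fin ℓ ⊕ Fin (ℓ + 1)) ℂ :=
  fromBlocks (V₁ α) (F₁ f * V₁' α) (V₂' α) (F₂ f * V₂ α)

theorem det_blockMatrix (α f : Fin (2 * ℓ + 1) → ℂ) : (blockMatrix α f).det = Delta α f := rfl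

theorem blockMatrix_inl (α f : Fin (2 * ℓ + 1) → ℂ) (r : Fin ℓ ⊕ Fin (ℓ + 1)) (j : Fin ℓ) :
    blockMatrix α f r (Sum.inl j) = α (rowEquiv ℓ r) ^ (j : ℕ) := by
  cases r <;> rfl

theorem blockMatrix_inr (α f : Fin (2 * ℓ + 1) → ℂ) (r : Fin ℓ ⊕ Fin (ℓ + 1))
    (j : Fin (ℓ + 1)) :
    blockMatrix α f r (Sum.inr j) = f (rowEquiv ℓ r) * α (rowEquiv ℓ r) ^ (j : ℕ) := by
  cases r
  · rw [blockMatrix, fromBlocks_apply₁₂, F₁, diagonal_mul]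
    rfl
  · rw [blockMatrix, fromBlocks_apply₂₂, F₂, diagonal_mul]
    rfl

theorem blockMatrix_mulVec (α f : Fin (2 * ℓ + 1) → ℂ) (u : Fin ℓ → ℂ) (v : Fin (ℓ + 1) → ℂ)
    (r : Fin ℓ ⊕ Fin (ℓ + 1)) :
    (blockMatrix α f *ᵥ Sum.elim u v) r = ∑ j, u j * α (rowEquiv ℓ r) ^ (j : ℕ) +
      f (rowEquiv ℓ r) * ∑ j, v j * α (rowEquiv ℓ r) ^ (j : ℕ) := by
  simp only [mulVec, dotProduct, Fintype.sum_sum_type, blockMatrix_inl, blockMatrix_inr,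
    Sum.elim_inl, Sum.elim_inr, Finset.mul_sum]
  congr 1
  · exact Finset.sum_congr rfl fun j _ => mul_comm _ _
  · exact Finset.sum_congr rfl fun j _ => by ring

theorem eq_zero_of_eval_add_eq_zero {α f : Fin (2 * ℓ + 1) → ℂ} (hΔ : Delta α f ≠ 0)
    {A B : ℂ[X]} (hA : A ∈ degreeLT ℂ ℓ) (hB : B.natDegree ≤ ℓ)
    (h : ∀ i, A.eval (α i) + f i * B.eval (α i) = 0) : A = 0 ∧ B = 0 := by
  have hB' : B ∈ degreeLT ℂ (ℓ + 1) := mem_degreeLT_succ.2 hB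
  have h0 : Sum.elim (degreeLTEquiv ℂ ℓ ⟨A, hA⟩) (degreeLTEquiv ℂ (ℓ + 1) ⟨B, hB'⟩) = 0 := by
    refine eq_zero_of_mulVec_eq_zero (M := blockMatrix α f) hΔ ?_
    funext r
    rw [blockMatrix_mulVec, ← eval_eq_sum_degreeLTEquiv hA, ← eval_eq_sum_degreeLTEquiv hB']
    exact h _
  constructor
  · rw [← degreeLTEquiv_eq_zero_iff_eq_zero hA]
    exact funext fun j => congrFun h0 (Sum.inl j)
  · rw [← degreeLTEquiv_eq_zero_iff_eq_zero hB']
    exact funext fun j => congrFun h0 (Sum.inr j)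

/-- The reversal of the columns `1, z, …, z^{ℓ-1}, z^ℓ, f z, …, f z^ℓ`, where the column `z^ℓ`
replaces, and is labelled by the index of, the column `f`. -/
def colRev (ℓ : ℕ) : Equiv.Perm (Fin ℓ ⊕ Fin (ℓ + 1)) :=
  Function.Involutive.toPerm
    (Sum.elim (fun j => Sum.inr j.rev.succ)
      (fun j => Fin.cases (Sum.inr 0) (fun i => Sum.inl i.rev) j)) (by
    rintro (j | j)
    · simp
    · cases j using Fin.cases <;> simp)

theorem colRev_inl (j : Fin ℓ) : colRev ℓ (Sum.inl j) = Sum.inr j.rev.succ := rfl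

theorem colRev_inr_zero : colRev ℓ (Sum.inr 0) = Sum.inr 0 := rfl

theorem colRev_inr_succ (j : Fin ℓ) : colRev ℓ (Sum.inr j.succ) = Sum.inl j.rev := rfl

/-- An involution of 2ℓ+1 points with one fixed point is a product of ℓ disjoint transpositions. -/
theorem sign_colRev (ℓ : ℕ) : Equiv.Perm.sign (colRev ℓ) = (-1) ^ ℓ := by
  have hsq : colRev ℓ ^ 2 = 1 := by
    ext1 x
    rw [pow_two, Equiv.Perm.mul_apply, Equiv.Perm.one_apply]
    exact Function.Involutive.toPerm_involutive _ x
  have hfix : Fintype.card (Function.fixedPoints (colRev ℓ)) = 1 := by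
    rw [Fintype.card_eq_one_iff]
    refine ⟨⟨Sum.inr 0, colRev_inr_zero⟩, ?_⟩
    rintro ⟨j | j, hj⟩
    · exact absurd hj (by simp [Function.IsFixedPt, colRev_inl])
    · cases j using Fin.cases with
      | zero => rfl
      | succ j => exact absurd hj (by simp [Function.IsFixedPt, colRev_inr_succ])
  rw [Equiv.Perm.sign_of_pow_two_eq_one hsq, hfix, Fintype.card_sum, Fintype.card_fin,
    Fintype.card_fin]
  congr 1
  omega

/-- Conjugating the block matrix and scaling each row by fα^ℓ turns a column z^j into f z^(ℓ-j) and
f z^j into z^(ℓ-j). These are the columns of the updated matrix, permuted by `colRev`. -/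
theorem det_updateCol_blockMatrix {α f : Fin (2 * ℓ + 1) → ℂ} (hα : ∀ i, ‖α i‖ = 1)
    (hf : ∀ i, ‖f i‖ = 1) :
    ((blockMatrix α f).updateCol (Sum.inr 0) fun r => α (rowEquiv ℓ r) ^ ℓ).det =
      (-1) ^ ℓ * (∏ j, f j * α j ^ ℓ) * conj (Delta α f) := by
  set N := (blockMatrix α f).updateCol (Sum.inr 0) fun r => α (rowEquiv ℓ r) ^ ℓ with hN
  have hunit : ∀ {w : ℂ}, ‖w‖ = 1 → w * conj w = 1 := fun {w} hw => by
    rw [Complex.mul_conj, Complex.normSq_eq_norm_sq, hw]; simp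
  have hpow : ∀ (r : Fin ℓ ⊕ Fin (ℓ + 1)) (i j : ℕ), i + j = ℓ →
      α (rowEquiv ℓ r) ^ ℓ * conj (α (rowEquiv ℓ r) ^ j) = α (rowEquiv ℓ r) ^ i := by
    intro r i j hij
    rw [show α (rowEquiv ℓ r) ^ ℓ = α (rowEquiv ℓ r) ^ (i + j) by rw [hij], pow_add, mul_assoc, map_pow, ← mul_pow, hunit (hα _), one_pow, mul_one]
  have hrev : N.submatrix id (colRev ℓ) = of fun r c =>
      (f (rowEquiv ℓ r) * α (rowEquiv ℓ r) ^ ℓ) *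
        ((starRingEnd ℂ).mapMatrix (blockMatrix α f)) r c := by
    ext r c
    rw [submatrix_apply, of_apply, RingHom.mapMatrix_apply, map_apply, id]
    rcases c with j | j
    · rw [colRev_inl, hN, updateCol_ne (by simp), blockMatrix_inr, blockMatrix_inl, mul_assoc,
        hpow r (j.rev.succ) j (by simp [Fin.val_rev]; omega)]
    · cases j using Fin.cases with
      | zero =>
        rw [colRev_inr_zero, hN, updateCol_self, blockMatrix_inr]
        simp only [Fin.val_zero, pow_zero, mul_one]
        linear_combination -(α (rowEquiv ℓ r) ^ ℓ) * hunit (hf (rowEquiv ℓ r))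
      | succ j =>
        rw [colRev_inr_succ, hN, updateCol_ne (by simp), blockMatrix_inr, blockMatrix_inl,
          ← hpow r j.rev j.succ (by simp [Fin.val_rev]), map_mul]
        linear_combination -(α (rowEquiv ℓ r) ^ ℓ * conj (α (rowEquiv ℓ r) ^ (j.succ : ℕ))) *
          hunit (hf (rowEquiv ℓ r))
  have h1 := det_permute' (colRev ℓ) N
  rw [hrev, det_mul_column, ← RingHom.map_det, det_blockMatrix, sign_colRev,
    (rowEquiv ℓ).prod_comp fun j => f j * α j ^ ℓ] at h1
  push_cast at h1
  rw [mul_assoc, h1, ← mul_assoc, ← mul_pow]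
  simp

/-- Cramer's rule; the minus sign on the right-hand side raises the exponent of -1 from ℓ to ℓ+1. -/
theorem eq_tauParam_of_mulVec {α f : Fin (2 * ℓ + 1) → ℂ} (hα : ∀ i, ‖α i‖ = 1)
    (hf : ∀ i, ‖f i‖ = 1) (hΔ : Delta α f ≠ 0) {x : Fin ℓ ⊕ Fin (ℓ + 1) → ℂ}
    (hx : ∀ r, (blockMatrix α f *ᵥ x) r = -α (rowEquiv ℓ r) ^ ℓ) :
    x (Sum.inr 0) = tauParam α f := by
  have h1 : blockMatrix α f *ᵥ x = (-1 : ℂ) • fun r => α (rowEquiv ℓ r) ^ ℓ := by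
    funext r
    rw [hx]
    simp
  have h2 : blockMatrix α f *ᵥ (cramer (blockMatrix α f) (blockMatrix α f *ᵥ x) -
      (blockMatrix α f).det • x) = 0 := by
    rw [mulVec_sub, mulVec_cramer, mulVec_smul, sub_self]
  have h3 := congrFun (eq_zero_of_mulVec_eq_zero (M := blockMatrix α f) hΔ h2) (Sum.inr 0)
  rw [Pi.sub_apply, h1, cramer_apply, det_updateCol_smul, det_updateCol_blockMatrix hα hf,
    Pi.smul_apply, Pi.zero_apply, det_blockMatrix, smul_eq_mul] at h3
  rw [tauParam, pow_succ]
  field_simp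
  linear_combination -h3

theorem isUnit_det_V₂ {α : Fin (2 * ℓ + 1) → ℂ} (hα : Function.Injective α) :
    IsUnit (V₂ α).det := by
  have h : V₂ α = vandermonde (sndPart α) := rfl
  rw [h, isUnit_iff_ne_zero, det_vandermonde_ne_zero_iff]
  intro i j hij
  have := congrArg Fin.val (hα hij)
  simp at this
  exact Fin.ext this

theorem conjF₂_mul_F₂ {f : Fin (2 * ℓ + 1) → ℂ} (hf : ∀ i, ‖f i‖ = 1) :
    F₂ f * conjF₂ f = 1 := by
  rw [conjF₂, F₂, diagonal_map (map_zero _), diagonal_mul_diagonal, ← diagonal_one]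
  congr 1
  funext i
  simp [Complex.mul_conj, Complex.normSq_eq_norm_sq, sndPart, hf]

/-- The coefficients of the companion polynomial of `polyP`. -/
noncomputable def rVec (α f : Fin (2 * ℓ + 1) → ℂ) : Fin (ℓ + 1) → ℂ :=
  -(((V₂ α)⁻¹ * conjF₂ f) *ᵥ (d₂ α + V₂' α *ᵥ pVec α f))

/-- `rVec` solves the lower block row for the second unknown; substituting it in the upper row
leaves the Schur complement of F₂V₂, invertible because Δ is its determinant times det(F₂V₂). -/
theorem blockMatrix_mulVec_pVec_rVec {α f : Fin (2 * ℓ + 1) → ℂ} (hα : Function.Injective α)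
    (hf : ∀ i, ‖f i‖ = 1) (hΔ : Delta α f ≠ 0) (r : Fin ℓ ⊕ Fin (ℓ + 1)) :
    (blockMatrix α f *ᵥ Sum.elim (pVec α f) (rVec α f)) r = -α (rowEquiv ℓ r) ^ ℓ := by
  have hV := isUnit_det_V₂ hα
  have hinv : (F₂ f * V₂ α) * ((V₂ α)⁻¹ * conjF₂ f) = 1 := by
    rw [Matrix.mul_assoc, ← Matrix.mul_assoc (V₂ α), mul_nonsing_inv _ hV, Matrix.one_mul,
      conjF₂_mul_F₂ hf]
  let _ : Invertible (F₂ f * V₂ α) := invertibleOfRightInverse _ _ hinv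
  have hinv' : ⅟(F₂ f * V₂ α) = (V₂ α)⁻¹ * conjF₂ f := rfl
  set S := V₁ α - F₁ f * V₁' α * (V₂ α)⁻¹ * conjF₂ f * V₂' α with hS
  have hSdet : IsUnit S.det := by
    rw [isUnit_iff_ne_zero]
    intro h
    apply hΔ
    rw [Delta, det_fromBlocks₂₂, hinv', ← Matrix.mul_assoc, ← hS, h, mul_zero]
  have hp : S *ᵥ pVec α f = -(d₁ α - (F₁ f * V₁' α * (V₂ α)⁻¹ * conjF₂ f) *ᵥ d₂ α) := by
    rw [pVec, mulVec_neg, mulVec_mulVec, ← hS, mul_nonsing_inv _ hSdet, one_mulVec]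
  rw [blockMatrix, fromBlocks_mulVec]
  rcases r with i | i
  · have h1 : V₁ α *ᵥ pVec α f + (F₁ f * V₁' α) *ᵥ rVec α f = -d₁ α := by
      rw [rVec, mulVec_neg, mulVec_mulVec, ← Matrix.mul_assoc, mulVec_add, mulVec_mulVec]
      rw [hS, sub_mulVec] at hp
      rw [neg_add, ← add_assoc, add_right_comm, ← sub_eq_add_neg (V₁ α *ᵥ _), hp]
      abel
    exact congrFun h1 i
  · have h2 : V₂' α *ᵥ pVec α f + (F₂ f * V₂ α) *ᵥ rVec α f = -d₂ α := by
      rw [rVec, mulVec_neg, mulVec_mulVec, hinv, one_mulVec]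
      abel
    exact congrFun h2 i

end LinearAlgebra

/-! ### The companion polynomial is τP^* -/

section Interpolation

variable {ℓ : ℕ}

theorem sum_C_mul_X_pow_mem_degreeLT {d : ℕ} (u : Fin d → ℂ) :
    ∑ j : Fin d, C (u j) * X ^ (j : ℕ) ∈ degreeLT ℂ d := by
  refine Submodule.sum_mem _ fun j _ => ?_
  rw [mem_degreeLT]
  exact (degree_C_mul_X_pow_le _ _).trans_lt (WithBot.coe_lt_coe.2 j.2)

theorem monic_natDegree_polyP (α f : Fin (2 * ℓ + 1) → ℂ) :
    (polyP α f).Monic ∧ (polyP α f).natDegree = ℓ := by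
  have h := mem_degreeLT.1 (sum_C_mul_X_pow_mem_degreeLT (pVec α f))
  refine ⟨monic_X_pow_add h, natDegree_eq_of_degree_eq_some ?_⟩
  rw [polyP, degree_add_eq_left_of_degree_lt (by rwa [degree_X_pow]), degree_X_pow]

theorem polyP_interpolation {α f : Fin (2 * ℓ + 1) → ℂ} (hα : ∀ i, ‖α i‖ = 1)
    (hα_inj : Function.Injective α) (hf : ∀ i, ‖f i‖ = 1) (hΔ : Delta α f ≠ 0) :
    ‖tauParam α f‖ = 1 ∧ ∀ i, (polyP α f).eval (α i) +
      f i * (C (tauParam α f) * recip ℓ (polyP α f)).eval (α i) = 0 := by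
  obtain ⟨hPmon, hPdeg⟩ := monic_natDegree_polyP α f
  have hsys := blockMatrix_mulVec_pVec_rVec hα_inj hf hΔ
  set P := polyP α f with hP
  set R : ℂ[X] := ∑ j : Fin (ℓ + 1), C (rVec α f j) * X ^ (j : ℕ) with hR
  set c := tauParam α f with hc
  have hRdeg : R.natDegree ≤ ℓ := mem_degreeLT_succ.1 (sum_C_mul_X_pow_mem_degreeLT (rVec α f))
  have hRc : R.coeff 0 = c := by
    rw [hc, ← eq_tauParam_of_mulVec hα hf hΔ hsys, hR, coeff_zero_eq_eval_zero, eval_finsetSum,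
      Finset.sum_eq_single 0]
    · simp
    · intro j _ hj
      have : (j : ℕ) ≠ 0 := fun h => hj (Fin.ext h)
      simp [this]
    · simp
  have hPR : ∀ i, P.eval (α i) + f i * R.eval (α i) = 0 := by
    intro i
    obtain ⟨r, rfl⟩ := (rowEquiv ℓ).surjective i
    have h1 := hsys r
    rw [blockMatrix_mulVec] at h1
    rw [hP, hR, polyP, eval_add, eval_finsetSum, eval_finsetSum]
    simp only [eval_mul, eval_C, eval_pow, eval_X]
    linear_combination h1
  have hunit : ∀ {w : ℂ}, ‖w‖ = 1 → w * conj w = 1 := fun {w} hw => by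
    rw [Complex.mul_conj, Complex.normSq_eq_norm_sq, hw]; simp
  have hRP : ∀ i, (recip ℓ R).eval (α i) + f i * (recip ℓ P).eval (α i) = 0 := by
    intro i
    have h1 := congrArg (starRingEnd ℂ) (hPR i)
    rw [map_add, map_mul, map_zero] at h1
    rw [eval_recip_of_norm_one hRdeg (hα i), eval_recip_of_norm_one hPdeg.le (hα i)]
    linear_combination f i * α i ^ ℓ * h1 -
      α i ^ ℓ * conj (R.eval (α i)) * hunit (hf i)
  -- Both terms have z^ℓ-coefficient conj c, so the difference drops into the space where Δ ≠ 0
  -- gives uniqueness.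
  have hA : C (conj c) * P - recip ℓ R ∈ degreeLT ℂ ℓ := by
    rw [mem_degreeLT, degree_lt_iff_coeff_zero]
    intro k hk
    rcases hk.eq_or_lt with rfl | hk
    · rw [coeff_sub, coeff_C_mul, coeff_recip le_rfl, Nat.sub_self, hRc]
      have hlead : P.coeff ℓ = 1 := by
        conv_lhs => rw [← hPdeg]
        exact hPmon.coeff_natDegree
      rw [hlead, mul_one, sub_self]
    · rw [coeff_sub, coeff_C_mul, coeff_eq_zero_of_natDegree_lt (hPdeg.trans_lt hk),
        coeff_eq_zero_of_natDegree_lt ((natDegree_recip_le hRdeg).trans_lt hk), mul_zero, sub_zero]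
  have hB : (C (conj c) * R - recip ℓ P).natDegree ≤ ℓ :=
    (natDegree_sub_le _ _).trans (max_le ((natDegree_C_mul_le _ _).trans hRdeg)
      (natDegree_recip_le hPdeg.le))
  have hBz := (eq_zero_of_eval_add_eq_zero hΔ hA hB fun i => by
    rw [eval_sub, eval_sub, eval_mul, eval_mul, eval_C]
    linear_combination conj c * hPR i - hRP i).2
  -- Compare constant terms in conj(c) R = P^*: R(0) = c, and P^*(0) = 1 because P is monic.
  have hcc : conj c * c = 1 := by
    have h1 := congrArg (fun T => coeff T 0) hBz
    simp only [coeff_sub, coeff_C_mul, hRc, coeff_zero_recip hPmon hPdeg, coeff_zero] at h1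
    linear_combination h1
  have hRcP : R = C c * recip ℓ P := by
    have h1 : C (conj c) * C c = (1 : ℂ[X]) := by rw [← C_mul, hcc, C_1]
    linear_combination C c * hBz - R * h1
  refine ⟨?_, hRcP ▸ hPR⟩
  have h1 := congrArg norm hcc
  rw [norm_mul, Complex.norm_conj, norm_one, ← pow_two] at h1
  exact (pow_eq_one_iff_of_nonneg (norm_nonneg _) two_ne_zero).1 h1

end Interpolation

/-! ### Zeros on the circle as interpolation conditions -/

section Zeros

variable {μ : Measure ℂ} [IsFiniteMeasure μ] {k : ℕ} {z w : ℂ}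

theorem eval_opuc_ne_zero (hμ : μ.support = Metric.sphere (0 : ℂ) 1) (m : ℕ) (hz : ‖z‖ = 1) :
    (opuc μ m).eval z ≠ 0 := fun h => (norm_lt_one_of_isRoot_opuc hμ h).ne hz

/-- On the circle F is unimodular, so conj F = 1/F = ρ^*/(zρ). -/
theorem conj_blaschkeF_mul (hμ : μ.support = Metric.sphere (0 : ℂ) 1) (hz : ‖z‖ = 1)
    (hw : w = conj (blaschkeF μ k z)) :
    ‖w‖ = 1 ∧ w * (z * (opuc μ (k - 1)).eval z) = (recip (k - 1) (opuc μ (k - 1))).eval z := by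
  have hρ := eval_opuc_ne_zero hμ (k - 1) hz
  have hz0 : z ≠ 0 := by rintro rfl; simp at hz
  have hzc : conj z = z⁻¹ := (Complex.inv_eq_conj hz).symm
  have hρc : conj ((opuc μ (k - 1)).eval z) ≠ 0 := (_root_.map_ne_zero _).2 hρ
  have hrec := eval_recip_of_norm_one (natDegree_opuc μ (k - 1)).le hz
  constructor
  · rw [hw, Complex.norm_conj, blaschkeF, hrec, norm_div, norm_mul, norm_mul, norm_pow, hz,
      Complex.norm_conj, one_pow, div_self (by simpa using hρ)]
  · rw [hw, blaschkeF, hrec, map_div₀, map_mul, map_mul, map_pow, Complex.conj_conj, hzc,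
      inv_pow]
    field_simp

theorem isRoot_X_mul_mul_opuc_add (hμ : μ.support = Metric.sphere (0 : ℂ) 1) (hz : ‖z‖ = 1)
    (hw : w = conj (blaschkeF μ k z)) (A B : ℂ[X]) :
    (X * A * opuc μ (k - 1) + B * recip (k - 1) (opuc μ (k - 1))).IsRoot z ↔
      A.eval z + w * B.eval z = 0 := by
  have hz0 : z ≠ 0 := by rintro rfl; simp at hz
  have h : (X * A * opuc μ (k - 1) + B * recip (k - 1) (opuc μ (k - 1))).eval z =
      z * (opuc μ (k - 1)).eval z * (A.eval z + w * B.eval z) := by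
    rw [eval_add, eval_mul, eval_mul, eval_mul, eval_X, ← (conj_blaschkeF_mul hμ hz hw).2]
    ring
  rw [IsRoot.def, h, mul_eq_zero, or_iff_right (mul_ne_zero hz0 (eval_opuc_ne_zero hμ _ hz))]

end Zeros

/-! ### Uniqueness from the prescribed zeros -/

section Uniqueness

variable {μ : Measure ℂ} {n ℓ : ℕ}

/-- Only zAρ_m reaches degree n, since Bρ_m^* has degree at most ℓ+m = n-1. -/
theorem coeff_eq_one_of_monic {A B : ℂ[X]} (hn : 2 * ℓ + 1 ≤ n) (hA : A.natDegree ≤ ℓ)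
    (hB : B.natDegree ≤ ℓ)
    (hmon : (X * A * opuc μ (n - ℓ - 1) +
      B * recip (n - ℓ - 1) (opuc μ (n - ℓ - 1))).coeff n = 1) : A.coeff ℓ = 1 := by
  obtain ⟨m, rfl⟩ : ∃ m, n = ℓ + m + 1 := ⟨n - ℓ - 1, by omega⟩
  rw [show ℓ + m + 1 - ℓ - 1 = m by omega, coeff_add, mul_assoc, coeff_X_mul,
    coeff_mul_add_eq_of_natDegree_le hA (natDegree_opuc μ m).le, coeff_eq_zero_of_natDegree_lt (p := B * _), add_zero]
    at hmon
  · have h : (opuc μ m).coeff m = 1 := by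
      have := (monic_opuc μ m).coeff_natDegree
      rwa [natDegree_opuc] at this
    rwa [h, mul_one] at hmon
  · have h1 := natDegree_mul_le (p := B) (q := recip m (opuc μ m))
    have h2 := natDegree_recip_le (natDegree_opuc μ m).le
    omega

theorem eq_of_monic_of_isRoot [IsFiniteMeasure μ] (hμ : μ.support = Metric.sphere (0 : ℂ) 1) (hn : 2 * ℓ + 1 ≤ n)
    {α f : Fin (2 * ℓ + 1) → ℂ} (hα : ∀ i, ‖α i‖ = 1)
    (hf : ∀ i, f i = conj (blaschkeF μ (n - ℓ) (α i))) (hΔ : Delta α f ≠ 0) {Q Q' : ℂ[X]}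
    (hQ : Q.Monic) (hQdeg : Q.natDegree = n) (hQorth : ∀ R ∈ testSpace n ℓ, ip μ Q R = 0)
    (hQroot : ∀ i, Q.IsRoot (α i))
    (hQ' : Q'.Monic) (hQdeg' : Q'.natDegree = n) (hQorth' : ∀ R ∈ testSpace n ℓ, ip μ Q' R = 0)
    (hQroot' : ∀ i, Q'.IsRoot (α i)) : Q' = Q := by
  obtain ⟨A, B, hA, hB, rfl⟩ := exists_eq_X_mul_mul_opuc_add hμ hn hQdeg.le hQorth
  obtain ⟨A', B', hA', hB', rfl⟩ := exists_eq_X_mul_mul_opuc_add hμ hn hQdeg'.le hQorth'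
  have hl : A.coeff ℓ = 1 := coeff_eq_one_of_monic (μ := μ) hn hA hB (by
    have := hQ.coeff_natDegree
    rwa [hQdeg] at this)
  have hl' : A'.coeff ℓ = 1 := coeff_eq_one_of_monic (μ := μ) hn hA' hB' (by
    have := hQ'.coeff_natDegree
    rwa [hQdeg'] at this)
  have hdiff : A' - A ∈ degreeLT ℂ ℓ := by
    rw [mem_degreeLT, degree_lt_iff_coeff_zero]
    intro k hk
    rcases hk.eq_or_lt with rfl | hk
    · rw [coeff_sub, hl, hl', sub_self]
    · rw [coeff_sub, coeff_eq_zero_of_natDegree_lt (hA.trans_lt hk),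
        coeff_eq_zero_of_natDegree_lt (hA'.trans_lt hk), sub_zero]
  have hdiffB : (B' - B).natDegree ≤ ℓ := (natDegree_sub_le _ _).trans (max_le hB' hB)
  obtain ⟨h1, h2⟩ := eq_zero_of_eval_add_eq_zero hΔ hdiff hdiffB fun i => by
    have e := (isRoot_X_mul_mul_opuc_add hμ (hα i) (hf i) A B).1 (hQroot i)
    have e' := (isRoot_X_mul_mul_opuc_add hμ (hα i) (hf i) A' B').1 (hQroot' i)
    rw [eval_sub, eval_sub]
    linear_combination e' - e
  rw [sub_eq_zero.1 h1, sub_eq_zero.1 h2]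

end Uniqueness

end QPOPUC

theorem theorem3p10
    (μ : MeasureTheory.Measure ℂ) [MeasureTheory.IsFiniteMeasure μ]
    (hμ : μ.support = Metric.sphere (0 : ℂ) 1)
    (n ℓ : ℕ) (hn : 2 * ℓ + 1 ≤ n)
    (α : Fin (2 * ℓ + 1) → ℂ) (hα : ∀ i, ‖α i‖ = 1) (hα_inj : Function.Injective α)
    (f : Fin (2 * ℓ + 1) → ℂ)
    (hf : ∀ i, f i = (starRingEnd ℂ) (QPOPUC.blaschkeF μ (n - ℓ) (α i)))
    (hf_inj : Function.Injective f)
    (hΔ : QPOPUC.Delta α f ≠ 0)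
    (hP : QPOPUC.SchurCohn ℓ (QPOPUC.polyP α f)) :
    ∃ Q : ℂ[X],
      (Q.Monic ∧ QPOPUC.IsQPOPUC μ n ℓ Q ∧ QPOPUC.AllZerosSimpleOnCircle Q ∧
        ∀ i, Q.IsRoot (α i)) ∧
      (∀ Q' : ℂ[X],
        (Q'.Monic ∧ QPOPUC.IsQPOPUC μ n ℓ Q' ∧ QPOPUC.AllZerosSimpleOnCircle Q' ∧
          ∀ i, Q'.IsRoot (α i)) → Q' = Q) ∧
      Q = X * QPOPUC.polyP α f * QPOPUC.opuc μ (n - ℓ - 1) +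
        C (QPOPUC.tauParam α f) * QPOPUC.recip ℓ (QPOPUC.polyP α f) *
          QPOPUC.recip (n - ℓ - 1) (QPOPUC.opuc μ (n - ℓ - 1)) ∧
      QPOPUC.IsInvariantWith n (QPOPUC.tauParam α f) Q := by
  have hfu : ∀ i, ‖f i‖ = 1 := fun i => (QPOPUC.conj_blaschkeF_mul hμ (hα i) (hf i)).1
  obtain ⟨hPmon, hPdeg⟩ := QPOPUC.monic_natDegree_polyP α f
  obtain ⟨hτ, hint⟩ := QPOPUC.polyP_interpolation hα hα_inj hfu hΔ
  have hProots := QPOPUC.norm_lt_one_of_schurCohn hPmon hPdeg hP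
  set P := QPOPUC.polyP α f
  set τ := QPOPUC.tauParam α f
  set m := n - ℓ - 1 with hm
  have hnm : n = ℓ + m + 1 := by omega
  set ρ := QPOPUC.opuc μ m with hρ
  have hρmon : ρ.Monic := QPOPUC.monic_opuc μ m
  have hρdeg : ρ.natDegree = m := QPOPUC.natDegree_opuc μ m
  have hHmon : (P * ρ).Monic := hPmon.mul hρmon
  have hHdeg : (P * ρ).natDegree = ℓ + m := by rw [hPmon.natDegree_mul hρmon, hPdeg, hρdeg]
  have hHroots : ∀ z, (P * ρ).IsRoot z → ‖z‖ < 1 := by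
    intro z hz
    rw [IsRoot.def, eval_mul, mul_eq_zero] at hz
    exact hz.elim (hProots z) (QPOPUC.norm_lt_one_of_isRoot_opuc hμ)
  -- Multiplicativity of the reciprocal brings Q to the form zH + τH^* with H = Pρ.
  have hQH : X * P * ρ + C τ * QPOPUC.recip ℓ P * QPOPUC.recip m ρ =
      X * (P * ρ) + C τ * QPOPUC.recip (ℓ + m) (P * ρ) := by
    rw [QPOPUC.recip_mul hPdeg.le hρdeg.le, mul_assoc, mul_assoc]
  obtain ⟨hQmon, hQdeg⟩ := QPOPUC.monic_X_mul_add hHmon hHdeg τ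
  have hsimple := QPOPUC.allZerosSimpleOnCircle_X_mul_add hHmon hHdeg hHroots hτ
  have hinv := QPOPUC.recip_X_mul_add hHdeg.le hτ
  rw [← hQH] at hQmon hQdeg hsimple hinv
  rw [← hnm] at hQdeg hinv
  have hinv' : QPOPUC.IsInvariantWith n τ
      (X * P * ρ + C τ * QPOPUC.recip ℓ P * QPOPUC.recip m ρ) :=
    ⟨hτ, by rw [degree_eq_natDegree hQmon.ne_zero, hQdeg], hinv⟩
  have hBdeg : (C τ * QPOPUC.recip ℓ P).natDegree ≤ ℓ :=
    (natDegree_C_mul_le _ _).trans (QPOPUC.natDegree_recip_le hPdeg.le)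
  have horth : ∀ R ∈ QPOPUC.testSpace n ℓ,
      QPOPUC.ip μ (X * P * ρ + C τ * QPOPUC.recip ℓ P * QPOPUC.recip m ρ) R = 0 :=
    fun R hR => QPOPUC.ip_mul_opuc_add_of_mem_testSpace hμ hPdeg.le hBdeg hR
  have hroot : ∀ i, (X * P * ρ + C τ * QPOPUC.recip ℓ P * QPOPUC.recip m ρ).IsRoot (α i) :=
    fun i => (QPOPUC.isRoot_X_mul_mul_opuc_add hμ (hα i) (hf i) _ _).2 (hint i)
  refine ⟨_, ⟨hQmon, ⟨⟨τ, hinv'⟩, horth⟩, hsimple, hroot⟩, ?_, rfl, hinv'⟩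
  rintro Q' ⟨hQ'mon, ⟨⟨σ, hσ⟩, horth'⟩, -, hroot'⟩
  exact QPOPUC.eq_of_monic_of_isRoot hμ hn hα hf hΔ hQmon hQdeg horth hroot hQ'mon
    (natDegree_eq_of_degree_eq_some hσ.2.1) horth' hroot'
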